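/- Let $Q$ be a generalized quantifier of type $\langle q\rangle$, i.e. a class of structures $(M,A)$ with $M\neq\emptyset$ and $A\subseteq M^q$; put $Q_M=\{A\subseteq M^q : (M,A)\in Q\}$. Assume that $Q$ is monotone increasing (if $A\subseteq B\subseteq M^q$ and $A\in Q_M$, then $B\in Q_M$) and non-trivial ($\emptyset\notin Q_M$ and $M^q\in Q_M$ for every non-empty $M$). The formulas of $\mathrm{ESO}(Q)$ are built from atomic and negated atomic formulas by $\wedge$, $\vee$, first-order $\exists x$ and $\forall x$, $Q\bar x$, and second-order existential quantification over relations and over functions; here $\mathbb M,s\models Q\bar x\,\varphi$ iff $\{\bar a\in M^q : \mathbb M,s[\bar a/\bar x]\models\varphi\}\in Q_M$, and the other clauses are the usual ones. A team $X$ of $M$ with domain a finite set $V$ of variables is a set of assignments $s:V\to M$. The formulas of $\mathrm I(Q)$ are built from first-order atomic formulas, independence atoms $\bar y\perp_{\bar x}\bar z$ (for tuples of variables) and the negations of both by $\wedge$, $\vee$, $\exists y$, $\forall y$ and $Q\bar x$. Their team semantics is: a first-order atomic or negated atomic formula holds in $X$ iff every $s\in X$ satisfies it; $\mathbb M,X\models\bar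 y\perp_{\bar x}\bar z$ iff for all $s,s'\in X$ with $s(\bar x)=s'(\bar x)$ there is $s_0\in X$ with $s_0(\bar x)=s(\bar x)$, $s_0(\bar y)=s(\bar y)$ and $s_0(\bar z)=s'(\bar z)$; a negated independence atom holds iff $X=\emptyset$; $\mathbb M,X\models\varphi\wedge\psi$ iff both $\mathbb M,X\models\varphi$ and $\mathbb M,X\models\psi$; $\mathbb M,X\models\varphi\vee\psi$ iff $X=Y\cup Z$ for some $Y,Z$ with $\mathbb M,Y\models\varphi$ and $\mathbb M,Z\models\psi$; $\mathbb M,X\models\exists y\,\varphi$ iff there is $f:X\to M$ with $\mathbb M,\{s[f(s)/y] : s\in X\}\models\varphi$; $\mathbb M,X\models\forall y\,\varphi$ iff $\mathbb M,\{s[a/y] : s\in X,\ a\in M\}\models\varphi$; $\mathbb M,X\models Q\bar x\,\varphi$ iff there is $F:X\to Q_M$ with $\mathbb M,\{s[\bar a/\bar x] : s\in X,\ \bar a\in F(s)\}\models\varphi$. For a team $X$ with domain $\{z_1,\dots,z_k\}$ (distinct variables) let $\mathrm{rel}(X)=\{(s(z_1),\dots,s(z_k)) : s\in X\}$. Theorem.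 Let $\tau$ be a signature and $R$ a $k$-ary relation symbol with $R\notin\tau$. Then for every $\tau\cup\{R\}$-sentence $\psi$ of $\mathrm{ESO}(Q)$ there is a $\tau$-formula $\varphi$ of $\mathrm I(Q)$ with free variables $\bar z=z_1,\dots,z_k$ such that for all $\tau$-structures $\mathbb M$ with non-empty universe and all teams $X$ of $M$ with domain $\{z_1,\dots,z_k\}$, $$\mathbb M,X\models\varphi\iff(\mathbb M,\mathrm{rel}(X))\models\psi\vee\forall\bar y\,\neg R(\bar y).$$ -/

import Mathlib

open FirstOrder FirstOrder.Language

universe u v w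

/-! ### Generalized quantifiers -/

/-- A generalized quantifier of type `⟨q⟩`: a class of structures `(M, A)` with `A ⊆ M ^ q`, given by
its local versions `Q M = {A ⊆ M ^ q | (M, A) ∈ Q}`. -/
abbrev GenQuantifier (q : ℕ) : Type (w + 1) := ∀ M : Type w, Set (Set (Fin q → M))

/-- `Q` is monotone increasing. Universes of structures are non-empty. -/
def GenQuantifier.IsMonotone {q : ℕ} (Q : GenQuantifier.{w} q) : Prop :=
  ∀ (M : Type w) [Nonempty M] (A B : Set (Fin q → M)), A ⊆ B → A ∈ Q M → B ∈ Q M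

/-- `Q` is non-trivial: `(M, ∅) ∉ Q` and `(M, M ^ q) ∈ Q` for all universes `M`. -/
def GenQuantifier.IsNontrivial {q : ℕ} (Q : GenQuantifier.{w} q) : Prop :=
  ∀ (M : Type w) [Nonempty M], (∅ : Set (Fin q → M)) ∉ Q M ∧ (Set.univ : Set (Fin q → M)) ∈ Q M

/-! ### Adding one symbol to a signature -/

/-- A family with exactly one element, of arity `r`. -/
inductive OneSym (r : ℕ) : ℕ → Type
  | sym : OneSym r r

/-- The signature with a single relation symbol, of arity `r`. -/
def oneRel (r : ℕ) : FirstOrder.Language.{0, 0} := ⟨fun _ => Empty, OneSym r⟩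

/-- The signature with a single function symbol, of arity `r`. -/
def oneFun (r : ℕ) : FirstOrder.Language.{0, 0} := ⟨OneSym r, fun _ => Empty⟩

/-- `(M, P)` as a structure for `oneRel r`. -/
abbrev relStructure {M : Type w} {r : ℕ} (P : Set (Fin r → M)) : (oneRel r).Structure M where
  funMap := fun f _ => nomatch f
  RelMap := fun R x => match R, x with
    | OneSym.sym, x => x ∈ P

/-- `(M, g)` as a structure for `oneFun r`. -/
abbrev funStructure {M : Type w} {r : ℕ} (g : (Fin r → M) → M) : (oneFun r).Structure M where
  funMap := fun f x => match f, x with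
    | OneSym.sym, x => g x
  RelMap := fun R _ => nomatch R

/-- The signature `L ∪ {R}`, where `R` is a relation symbol of arity `r` that is not in `L`. -/
abbrev withRel (L : FirstOrder.Language.{u, v}) (r : ℕ) : FirstOrder.Language.{u, v} := L.sum (oneRel r)

/-- The signature `L ∪ {f}`, where `f` is a function symbol of arity `r` that is not in `L`. -/
abbrev withFun (L : FirstOrder.Language.{u, v}) (r : ℕ) : FirstOrder.Language.{u, v} := L.sum (oneFun r)

/-- The expansion `(𝕄, P)` of an `L`-structure `𝕄` by a relation `P`. -/
abbrev expandRel {L : FirstOrder.Language.{u, v}} {M : Type w} (str : L.Structure M) {r : ℕ}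
    (P : Set (Fin r → M)) : (withRel L r).Structure M :=
  letI := str
  letI := relStructure P
  L.sumStructure (oneRel r) M

/-- The expansion `(𝕄, g)` of an `L`-structure `𝕄` by a function `g`. -/
abbrev expandFun {L : FirstOrder.Language.{u, v}} {M : Type w} (str : L.Structure M) {r : ℕ}
    (g : (Fin r → M) → M) : (withFun L r).Structure M :=
  letI := str
  letI := funStructure g
  L.sumStructure (oneFun r) M

/-! ### Assignments

Formulas are well-scoped: a formula over a set `α` of variables may use the variables in `α`, and a
quantifier that binds an `n`-tuple of variables is applied to a formula over `α ⊕ Fin n`, where the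
elements of `Fin n` are new variables. (So a quantifier never rebinds a variable.) -/

/-- The assignment `s[a/x]`, where `x` is a tuple of `n` new variables. -/
abbrev extendBy {α : Type} {M : Type w} {n : ℕ} (s : α → M) (a : Fin n → M) : α ⊕ Fin n → M :=
  Sum.elim s a

/-- The assignment `s[a/x]`, where `x` is one new variable. -/
abbrev extendOne {α : Type} {M : Type w} (s : α → M) (a : M) : α ⊕ Fin 1 → M :=
  extendBy s (fun _ => a)

/-! ### The logic `ESO(Q)` -/

/-- The `L`-formulas of `ESO(Q)` over the set `α` of first-order variables, for a quantifier symbol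
`Q` of type `⟨q⟩`: built from atomic and negated atomic formulas by conjunction, disjunction,
first-order quantification, `Q` quantification, and existential second-order quantification over
relations and functions. A second-order variable is a new symbol of the signature. -/
inductive ESOFormula (q : ℕ) : FirstOrder.Language.{u, v} → Type → Type (max (u + 1) (v + 1) 1)
  | eq {L : FirstOrder.Language.{u, v}} {α : Type} (t₁ t₂ : L.Term α) : ESOFormula q L α
  | neq {L : FirstOrder.Language.{u, v}} {α : Type} (t₁ t₂ : L.Term α) : ESOFormula q L α
  | rel {L : FirstOrder.Language.{u, v}} {α : Type} {n : ℕ} (R : L.Relations n) (ts : Fin n → L.Term α) :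
      ESOFormula q L α
  | nrel {L : FirstOrder.Language.{u, v}} {α : Type} {n : ℕ} (R : L.Relations n) (ts : Fin n → L.Term α) :
      ESOFormula q L α
  | and {L : FirstOrder.Language.{u, v}} {α : Type} (φ₁ φ₂ : ESOFormula q L α) : ESOFormula q L α
  | or {L : FirstOrder.Language.{u, v}} {α : Type} (φ₁ φ₂ : ESOFormula q L α) : ESOFormula q L α
  | ex {L : FirstOrder.Language.{u, v}} {α : Type} (φ : ESOFormula q L (α ⊕ Fin 1)) : ESOFormula q L α
  | all {L : FirstOrder.Language.{u, v}} {α : Type} (φ : ESOFormula q L (α ⊕ Fin 1)) : ESOFormula q L α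
  | gq {L : FirstOrder.Language.{u, v}} {α : Type} (φ : ESOFormula q L (α ⊕ Fin q)) : ESOFormula q L α
  | exRel {L : FirstOrder.Language.{u, v}} {α : Type} (r : ℕ) (φ : ESOFormula q (withRel L r) α) :
      ESOFormula q L α
  | exFun {L : FirstOrder.Language.{u, v}} {α : Type} (r : ℕ) (φ : ESOFormula q (withFun L r) α) :
      ESOFormula q L α

/-- `𝕄, s ⊨ φ` for a formula `φ` of `ESO(Q)`, where `str` is the structure `𝕄` with universe `M`. -/
def ESOFormula.Realize {q : ℕ} (Q : GenQuantifier.{w} q) {M : Type w} :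
    {L : FirstOrder.Language.{u, v}} → {α : Type} → ESOFormula q L α → L.Structure M → (α → M) → Prop
  | _, _, .eq t₁ t₂, str, s => letI := str; t₁.realize s = t₂.realize s
  | _, _, .neq t₁ t₂, str, s => letI := str; t₁.realize s ≠ t₂.realize s
  | _, _, .rel R ts, str, s => letI := str; Structure.RelMap R (fun i => (ts i).realize s)
  | _, _, .nrel R ts, str, s => letI := str; ¬ Structure.RelMap R (fun i => (ts i).realize s)
  | _, _, .and φ₁ φ₂, str, s => φ₁.Realize Q str s ∧ φ₂.Realize Q str s
  | _, _, .or φ₁ φ₂, str, s => φ₁.Realize Q str s ∨ φ₂.Realize Q str s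
  | _, _, .ex φ, str, s => ∃ a : M, φ.Realize Q str (extendOne s a)
  | _, _, .all φ, str, s => ∀ a : M, φ.Realize Q str (extendOne s a)
  | _, _, .gq φ, str, s => {a : Fin q → M | φ.Realize Q str (extendBy s a)} ∈ Q M
  | _, _, .exRel r φ, str, s => ∃ P : Set (Fin r → M), φ.Realize Q (expandRel str P) s
  | _, _, .exFun r φ, str, s => ∃ g : (Fin r → M) → M, φ.Realize Q (expandFun str g) s

/-- Sentences of `ESO(Q)`. -/
abbrev ESOSentence (q : ℕ) (L : FirstOrder.Language.{u, v}) := ESOFormula q L Empty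

/-- `𝕄 ⊨ ψ` for a sentence `ψ` of `ESO(Q)`. -/
def ESOSentence.Models {q : ℕ} (Q : GenQuantifier.{w} q) {M : Type w} {L : FirstOrder.Language.{u, v}}
    (str : L.Structure M) (ψ : ESOSentence q L) : Prop :=
  ESOFormula.Realize Q ψ str (fun x => nomatch x)

/-! ### Independence logic with a generalized quantifier -/

/-- The `L`-formulas of `I(Q)`, in negation normal form, over the set `α` of variables, for a
quantifier symbol `Q` of type `⟨q⟩`. The formula `indep y x z` is the independence atom `y ⊥_x z`
for tuples `y`, `x`, `z` of variables, and `nindep y x z` is its negation. -/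
inductive IFormula (L : FirstOrder.Language.{u, v}) (q : ℕ) : Type → Type (max u v 1)
  | eq {α : Type} (t₁ t₂ : L.Term α) : IFormula L q α
  | neq {α : Type} (t₁ t₂ : L.Term α) : IFormula L q α
  | rel {α : Type} {n : ℕ} (R : L.Relations n) (ts : Fin n → L.Term α) : IFormula L q α
  | nrel {α : Type} {n : ℕ} (R : L.Relations n) (ts : Fin n → L.Term α) : IFormula L q α
  | indep {α : Type} {a b c : ℕ} (y : Fin a → α) (x : Fin b → α) (z : Fin c → α) : IFormula L q α
  | nindep {α : Type} {a b c : ℕ} (y : Fin a → α) (x : Fin b → α) (z : Fin c → α) : IFormula L q α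
  | and {α : Type} (φ₁ φ₂ : IFormula L q α) : IFormula L q α
  | or {α : Type} (φ₁ φ₂ : IFormula L q α) : IFormula L q α
  | ex {α : Type} (φ : IFormula L q (α ⊕ Fin 1)) : IFormula L q α
  | all {α : Type} (φ : IFormula L q (α ⊕ Fin 1)) : IFormula L q α
  | gq {α : Type} (φ : IFormula L q (α ⊕ Fin q)) : IFormula L q α

/-- The set of variables of a term. -/
def termVars {L : FirstOrder.Language.{u, v}} {α : Type} : L.Term α → Set α
  | .var x => {x}
  | .func _ ts => ⋃ i, termVars (ts i)

/-- The set of free variables of a formula of `I(Q)`; all variables of an independence atom are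
free. -/
def IFormula.FV {L : FirstOrder.Language.{u, v}} {q : ℕ} : {α : Type} → IFormula L q α → Set α
  | _, .eq t₁ t₂ => termVars t₁ ∪ termVars t₂
  | _, .neq t₁ t₂ => termVars t₁ ∪ termVars t₂
  | _, .rel _ ts => ⋃ i, termVars (ts i)
  | _, .nrel _ ts => ⋃ i, termVars (ts i)
  | _, .indep y x z => Set.range y ∪ Set.range x ∪ Set.range z
  | _, .nindep y x z => Set.range y ∪ Set.range x ∪ Set.range z
  | _, .and φ₁ φ₂ => φ₁.FV ∪ φ₂.FV
  | _, .or φ₁ φ₂ => φ₁.FV ∪ φ₂.FV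
  | _, .ex φ => {x | Sum.inl x ∈ φ.FV}
  | _, .all φ => {x | Sum.inl x ∈ φ.FV}
  | _, .gq φ => {x | Sum.inl x ∈ φ.FV}

/-- A team of `M` with domain `α`. -/
abbrev Team (α : Type) (M : Type w) : Type w := Set (α → M)

/-- The team semantics `𝕄, X ⊨ φ` of `I(Q)`. -/
def IFormula.Sat {L : FirstOrder.Language.{u, v}} {q : ℕ} (Q : GenQuantifier.{w} q) {M : Type w}
    [L.Structure M] : {α : Type} → IFormula L q α → Team α M → Prop
  | _, .eq t₁ t₂, X => ∀ s ∈ X, t₁.realize s = t₂.realize s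
  | _, .neq t₁ t₂, X => ∀ s ∈ X, t₁.realize s ≠ t₂.realize s
  | _, .rel R ts, X => ∀ s ∈ X, Structure.RelMap R (fun i => (ts i).realize s)
  | _, .nrel R ts, X => ∀ s ∈ X, ¬ Structure.RelMap R (fun i => (ts i).realize s)
  | _, .indep y x z, X => ∀ s ∈ X, ∀ s' ∈ X, s ∘ x = s' ∘ x →
      ∃ s₀ ∈ X, s₀ ∘ x = s ∘ x ∧ s₀ ∘ y = s ∘ y ∧ s₀ ∘ z = s' ∘ z
  | _, .nindep _ _ _, X => X = ∅
  | _, .and φ₁ φ₂, X => φ₁.Sat Q X ∧ φ₂.Sat Q X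
  | _, .or φ₁ φ₂, X => ∃ Y Z : Team _ M, X = Y ∪ Z ∧ φ₁.Sat Q Y ∧ φ₂.Sat Q Z
  | _, .ex φ, X => ∃ f : X → M, φ.Sat Q {t | ∃ s : X, t = extendOne s.1 (f s)}
  | _, .all φ, X => φ.Sat Q {t | ∃ s ∈ X, ∃ a : M, t = extendOne s a}
  | _, .gq φ, X => ∃ F : X → Set (Fin q → M), (∀ s, F s ∈ Q M) ∧
      φ.Sat Q {t | ∃ s : X, ∃ a ∈ F s, t = extendBy s.1 a}

/-- For a team `X` with domain `{z₁, …, z_k}`, the relation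
`rel(X) = {(s(z₁), …, s(z_k)) | s ∈ X}`. -/
def teamRel {α : Type} {M : Type w} {k : ℕ} (z : Fin k ≃ α) (X : Team α M) : Set (Fin k → M) :=
  {y | ∃ s ∈ X, y = fun i => s (z i)}

/-! ### Team semantics in terms of total choice functions -/

namespace IFormula

variable {L : FirstOrder.Language.{u, v}} {q : ℕ} {Q : GenQuantifier.{w} q} {M : Type w}
  [L.Structure M] {Γ : Type}

/-! The empty team satisfies every formula and also the disjunct `∀ y, ¬ R y`, so the work concerns
nonempty teams (`exists_express`).

The atom `y ⊥_x y` says that `y` is a function of `x`. Hence universally quantifying `c`, `x` and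
then existentially quantifying a `y` that depends on them amounts to quantifying a function whose
whole graph is carried by the team (`exists_ex_fun`). Inclusion atoms are definable from
independence atoms, and `g u = v` becomes the inclusion of `(u, v)` in the columns carrying the
graph (`Definable.funCode`). A nonempty relation is the agreement set of two functions
(`Definable.exists_agree_eq`), so relation quantifiers reduce to function quantifiers and a separate
case for `∅`.

The translation of `ESO(Q)` goes by induction (`Definable.realize`). The danger is that splitting or
extending the team loses parts of the graphs, and two one-sided invariants deal with it. From
formula to truth, it suffices that all rows lie on the graphs, which every subteam inherits. From
truth to formula, every graph point must be reachable with the current first-order assignment fixed;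
this survives when all splits and witnesses depend on that assignment alone. A function quantified
below first-order quantifiers depends on the assignment, hence the parameters `c`.

Finally `R` is coded by two functions whose agreement set is forced to be `rel(X)`. -/

theorem sat_empty : ∀ {Γ : Type} (φ : IFormula L q Γ), φ.Sat Q (∅ : Team Γ M) := by
  intro Γ φ
  induction φ with
  | eq | neq | rel | nrel | indep | nindep => simp [Sat]
  | and _ _ h₁ h₂ => exact ⟨h₁, h₂⟩
  | or _ _ h₁ h₂ => exact ⟨∅, ∅, by simp, h₁, h₂⟩
  | ex φ h => exact ⟨fun s => s.2.elim, by simpa using h⟩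
  | all φ h => simpa [Sat] using h
  | gq φ h => exact ⟨fun s => s.2.elim, fun s => s.2.elim, by simpa using h⟩

theorem sat_all (φ : IFormula L q (Γ ⊕ Fin 1)) (X : Team Γ M) :
    φ.all.Sat Q X ↔ φ.Sat Q {t | t ∘ Sum.inl ∈ X} := by
  have : {t : Γ ⊕ Fin 1 → M | ∃ s ∈ X, ∃ a : M, t = extendOne s a} = {t | t ∘ Sum.inl ∈ X} := by
    ext t
    constructor
    · rintro ⟨s, hs, a, rfl⟩
      exact hs
    · intro ht
      refine ⟨_, ht, t (Sum.inr 0), ?_⟩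
      funext i
      rcases i with i | i
      · rfl
      · rw [Subsingleton.elim i 0]; rfl
  rw [Sat, this]

/-- With a total choice function the extended team is cut out by a condition on assignments; the
values off `X` play no role. -/
theorem sat_ex [Nonempty M] (φ : IFormula L q (Γ ⊕ Fin 1)) (X : Team Γ M) :
    φ.ex.Sat Q X ↔
      ∃ f : (Γ → M) → M, φ.Sat Q {t | t ∘ Sum.inl ∈ X ∧ t (Sum.inr 0) = f (t ∘ Sum.inl)} := by
  have key : ∀ (f : X → M) (g : (Γ → M) → M), (∀ s : X, g s.1 = f s) →
      {t : Γ ⊕ Fin 1 → M | ∃ s : X, t = extendOne s.1 (f s)} =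
        {t | t ∘ Sum.inl ∈ X ∧ t (Sum.inr 0) = g (t ∘ Sum.inl)} := by
    intro f g hg
    ext t
    constructor
    · rintro ⟨s, rfl⟩
      exact ⟨s.2, (hg s).symm⟩
    · rintro ⟨ht, h0⟩
      refine ⟨⟨_, ht⟩, ?_⟩
      funext i
      rcases i with i | i
      · rfl
      · rw [Subsingleton.elim i 0, h0]; exact hg ⟨_, ht⟩
  classical
  constructor
  · rintro ⟨f, hf⟩
    obtain ⟨g, hg⟩ : ∃ g : (Γ → M) → M, ∀ s : X, g s.1 = f s :=
      ⟨fun s => if h : s ∈ X then f ⟨s, h⟩ else Classical.arbitrary M, fun s => dif_pos s.2⟩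
    exact ⟨g, by rwa [← key f g hg]⟩
  · rintro ⟨g, hg⟩
    refine ⟨fun s => g s.1, ?_⟩
    rwa [key _ g (fun s => rfl)]

theorem sat_gq (φ : IFormula L q (Γ ⊕ Fin q)) (X : Team Γ M) :
    φ.gq.Sat Q X ↔ ∃ F : (Γ → M) → Set (Fin q → M), (∀ s ∈ X, F s ∈ Q M) ∧
      φ.Sat Q {t | t ∘ Sum.inl ∈ X ∧ t ∘ Sum.inr ∈ F (t ∘ Sum.inl)} := by
  have key : ∀ (f : X → Set (Fin q → M)) (g : (Γ → M) → Set (Fin q → M)), (∀ s : X, g s.1 = f s) →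
      {t : Γ ⊕ Fin q → M | ∃ s : X, ∃ a ∈ f s, t = extendBy s.1 a} =
        {t | t ∘ Sum.inl ∈ X ∧ t ∘ Sum.inr ∈ g (t ∘ Sum.inl)} := by
    intro f g hg
    ext t
    constructor
    · rintro ⟨s, a, ha, rfl⟩
      exact ⟨s.2, by simpa [hg s] using ha⟩
    · rintro ⟨ht, h0⟩
      refine ⟨⟨_, ht⟩, t ∘ Sum.inr, ?_, (Sum.elim_comp_inl_inr t).symm⟩
      rwa [← hg ⟨_, ht⟩]
  classical
  constructor
  · rintro ⟨f, hf, h⟩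
    obtain ⟨g, hg⟩ : ∃ g : (Γ → M) → Set (Fin q → M), ∀ s : X, g s.1 = f s :=
      -- The default `∅` need not belong to `Q M`: membership is only demanded on `X`.
      ⟨fun s => if h : s ∈ X then f ⟨s, h⟩ else ∅, fun s => dif_pos s.2⟩
    exact ⟨g, fun s hs => hg ⟨s, hs⟩ ▸ hf ⟨s, hs⟩, by rwa [← key f g hg]⟩
  · rintro ⟨g, hg, h⟩
    refine ⟨fun s => g s.1, fun s => hg _ s.2, ?_⟩
    rwa [key _ g (fun s => rfl)]

end IFormula

/-! ### Flat properties -/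

/-- The property `P` of assignments is defined, assignment by assignment, by a formula of `I(Q)`. -/
def FlatDefinable (L : FirstOrder.Language.{u, v}) {q : ℕ} (Q : GenQuantifier.{w} q) {Γ : Type}
    (P : ∀ (M : Type w), (Γ → M) → Prop) : Prop :=
  ∃ φ : IFormula L q Γ, ∀ (M : Type w) [L.Structure M] (X : Team Γ M),
    φ.Sat Q X ↔ ∀ s ∈ X, P M s

namespace FlatDefinable

variable {L : FirstOrder.Language.{u, v}} {q : ℕ} {Q : GenQuantifier.{w} q} {Γ : Type}

theorem eq (x y : Γ) : FlatDefinable L Q fun _ s => s x = s y :=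
  ⟨.eq (.var x) (.var y), fun _ _ _ => Iff.rfl⟩

theorem ne (x y : Γ) : FlatDefinable L Q fun _ s => s x ≠ s y :=
  ⟨.neq (.var x) (.var y), fun _ _ _ => Iff.rfl⟩

/-- Since `Γ` may be empty and `L` may have no constants, the truth constants come from independence
atoms on empty tuples. -/
theorem false : FlatDefinable L Q fun _ (_ : Γ → _) => False :=
  ⟨.nindep Fin.elim0 Fin.elim0 Fin.elim0, fun _ _ _ => by
    simp [IFormula.Sat, Set.eq_empty_iff_forall_notMem]⟩

theorem true : FlatDefinable L Q fun _ (_ : Γ → _) => True :=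
  ⟨.indep Fin.elim0 Fin.elim0 Fin.elim0, fun _ _ _ => by
    simp only [implies_true, iff_true]
    exact fun s hs s' _ _ => ⟨s, hs, rfl, rfl, Subsingleton.elim _ _⟩⟩

variable {P P' : ∀ (M : Type w), (Γ → M) → Prop}

/-- A flat disjunct is closed under subteams, so its part of a split may be shrunk to the complement
of the other part. -/
theorem or_sat (h : FlatDefinable L Q P) (ψ : IFormula L q Γ) :
    ∃ φ : IFormula L q Γ, ∀ (M : Type w) [L.Structure M] (X : Team Γ M),
      φ.Sat Q X ↔ ∃ Y ⊆ X, ψ.Sat Q Y ∧ ∀ s ∈ X, s ∉ Y → P M s := by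
  obtain ⟨φ, hφ⟩ := h
  refine ⟨.or φ ψ, fun M _ X => ?_⟩
  constructor
  · rintro ⟨Z, Y, rfl, hZ, hY⟩
    exact ⟨Y, Set.subset_union_right, hY, fun s hs hn => (hφ M Z).1 hZ s (hs.resolve_right hn)⟩
  · rintro ⟨Y, hYX, hY, hP⟩
    refine ⟨X \ Y, Y, (Set.sdiff_union_of_subset hYX).symm, (hφ M _).2 ?_, hY⟩
    exact fun s hs => hP s hs.1 hs.2

theorem and (h : FlatDefinable L Q P) (h' : FlatDefinable L Q P') :
    FlatDefinable L Q fun M s => P M s ∧ P' M s := by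
  obtain ⟨φ, hφ⟩ := h
  obtain ⟨ψ, hψ⟩ := h'
  exact ⟨.and φ ψ, fun M _ X => by simp only [IFormula.Sat, hφ, hψ, ← forall₂_and]⟩

theorem or (h : FlatDefinable L Q P) (h' : FlatDefinable L Q P') :
    FlatDefinable L Q fun M s => P M s ∨ P' M s := by
  obtain ⟨ψ, hψ⟩ := h'
  obtain ⟨φ, hφ⟩ := h.or_sat ψ
  refine ⟨φ, fun M _ X => ?_⟩
  rw [hφ]
  constructor
  · rintro ⟨Y, hYX, hY, hP⟩ s hs
    by_cases hsY : s ∈ Y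
    · exact Or.inr ((hψ M Y).1 hY s hsY)
    · exact Or.inl (hP s hs hsY)
  · intro h
    refine ⟨{s ∈ X | P' M s}, Set.sep_subset _ _, (hψ M _).2 fun s hs => hs.2, fun s hs hn => ?_⟩
    exact (h s hs).resolve_right fun h' => hn ⟨hs, h'⟩

theorem exists_fin : ∀ {n : ℕ} {P : Fin n → ∀ (M : Type w), (Γ → M) → Prop},
    (∀ i, FlatDefinable L Q (P i)) → FlatDefinable L Q fun M s => ∃ i, P i M s
  | 0, _, _ => by simpa using FlatDefinable.false
  | _ + 1, _, h => by
    simp only [Fin.exists_fin_succ]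
    exact (h 0).or (exists_fin fun i => h i.succ)

theorem forall_fin : ∀ {n : ℕ} {P : Fin n → ∀ (M : Type w), (Γ → M) → Prop},
    (∀ i, FlatDefinable L Q (P i)) → FlatDefinable L Q fun M s => ∀ i, P i M s
  | 0, _, _ => by simpa using FlatDefinable.true
  | _ + 1, _, h => by
    simp only [Fin.forall_fin_succ]
    exact (h 0).and (forall_fin fun i => h i.succ)

theorem tuple_eq {n : ℕ} (x y : Fin n → Γ) : FlatDefinable L Q fun _ s => s ∘ x = s ∘ y := by
  simp only [funext_iff]
  exact forall_fin fun i => eq (x i) (y i)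

theorem tuple_ne {n : ℕ} (x y : Fin n → Γ) : FlatDefinable L Q fun _ s => s ∘ x ≠ s ∘ y := by
  simp only [Function.ne_iff]
  exact exists_fin fun i => ne (x i) (y i)

end FlatDefinable

/-! ### Quantifying tuples, inclusion atoms and functions -/

section

variable (L : FirstOrder.Language.{u, v}) {q : ℕ} (Q : GenQuantifier.{w} q)

theorem exists_all_tuple (n : ℕ) : ∀ Γ : Type, ∃ (Γ' : Type) (j : Γ → Γ') (x : Fin n → Γ'),
    (∀ (M : Type w) (s : Γ → M) (a : Fin n → M), ∃ t : Γ' → M, t ∘ j = s ∧ t ∘ x = a) ∧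
    ∀ φ' : IFormula L q Γ', ∃ φ : IFormula L q Γ, ∀ (M : Type w) [L.Structure M] (X : Team Γ M),
      φ.Sat Q X ↔ φ'.Sat Q {t | t ∘ j ∈ X} := by
  induction n with
  | zero =>
    exact fun Γ => ⟨Γ, id, Fin.elim0, fun M s a => ⟨s, rfl, Subsingleton.elim _ _⟩,
      fun φ' => ⟨φ', fun M _ X => Iff.rfl⟩⟩
  | succ n ih =>
    intro Γ
    obtain ⟨Γ', j, x, hs, hφ⟩ := ih (Γ ⊕ Fin 1)
    refine ⟨Γ', j ∘ Sum.inl, Fin.cons (j (Sum.inr 0)) x, fun M s a => ?_, fun φ' => ?_⟩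
    · obtain ⟨t, ht, hx⟩ := hs M (extendOne s (a 0)) (Fin.tail a)
      refine ⟨t, by rw [← Function.comp_assoc, ht]; rfl, ?_⟩
      funext i
      refine Fin.cases ?_ (fun i => ?_) i
      · exact congrFun ht (Sum.inr 0)
      · exact congrFun hx i
    · obtain ⟨φ, h⟩ := hφ φ'
      exact ⟨φ.all, fun M _ X => by rw [IFormula.sat_all, h]; rfl⟩

theorem exists_all_tuple₂ (m n : ℕ) (Γ : Type) :
    ∃ (Γ' : Type) (j : Γ → Γ') (x : Fin m → Γ') (y : Fin n → Γ'),
    (∀ (M : Type w) (s : Γ → M) (a : Fin m → M) (b : Fin n → M),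
      ∃ t : Γ' → M, t ∘ j = s ∧ t ∘ x = a ∧ t ∘ y = b) ∧
    ∀ φ' : IFormula L q Γ', ∃ φ : IFormula L q Γ, ∀ (M : Type w) [L.Structure M] (X : Team Γ M),
      φ.Sat Q X ↔ φ'.Sat Q {t | t ∘ j ∈ X} := by
  obtain ⟨Γ₁, j₁, x, hs₁, h₁⟩ := exists_all_tuple L Q m Γ
  obtain ⟨Γ₂, j₂, y, hs₂, h₂⟩ := exists_all_tuple L Q n Γ₁
  refine ⟨Γ₂, j₂ ∘ j₁, j₂ ∘ x, y, fun M s a b => ?_, fun φ' => ?_⟩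
  · obtain ⟨t₁, rfl, rfl⟩ := hs₁ M s a
    obtain ⟨t₂, rfl, rfl⟩ := hs₂ M t₁ b
    exact ⟨t₂, rfl, rfl, rfl⟩
  · obtain ⟨φ₁, hφ₁⟩ := h₂ φ'
    obtain ⟨φ, hφ⟩ := h₁ φ₁
    exact ⟨φ, fun M _ X => by rw [hφ, hφ₁]; rfl⟩

/-- Inclusion atoms are definable from independence atoms. -/
theorem exists_inclusion_fin {Γ : Type} {n : ℕ} (x z : Fin n → Γ) :
    ∃ φ : IFormula L q Γ, ∀ (M : Type w) [L.Structure M] (X : Team Γ M),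
      φ.Sat Q X ↔ ∀ s ∈ X, ∃ s' ∈ X, s' ∘ z = s ∘ x := by
  obtain ⟨Γ', j, w, v, hex, hall⟩ := exists_all_tuple₂ L Q n 2 Γ
  obtain ⟨g, hg⟩ : FlatDefinable L Q fun _ t => t (v 0) = t (v 1) ∨ t ∘ w = t ∘ (j ∘ z) :=
    (FlatDefinable.eq _ _).or (FlatDefinable.tuple_eq _ _)
  -- The flat disjunct releases only rows with `w ≠ z` and moreover `w ≠ x` or `v 0 ≠ v 1`. All
  -- others stay in `Y`, where `w` is independent of `v` and `v 0 = v 1 ∨ w = z`.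
  obtain ⟨φ', hφ'⟩ := (((FlatDefinable.tuple_ne w (j ∘ x)).or
    (FlatDefinable.ne (v 0) (v 1))).and (FlatDefinable.tuple_ne (L := L) (Q := Q) w (j ∘ z))).or_sat
      (.and g (.indep w Fin.elim0 v))
  obtain ⟨φ, hφ⟩ := hall φ'
  refine ⟨φ, fun M _ X => ?_⟩
  rw [hφ, hφ']
  constructor
  · rintro ⟨Y, hYX, ⟨hgY, hi⟩, hP⟩ s hs
    rw [hg] at hgY
    by_cases hM : Nontrivial M
    · obtain ⟨a, b, hab⟩ := hM
      obtain ⟨t, htj, htw, htv⟩ := hex M s (s ∘ x) ![a, a]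
      obtain ⟨t', htj', htw', htv'⟩ := hex M s (s ∘ z) ![a, b]
      have hv : t (v 0) = t (v 1) := by
        rw [show t (v 0) = _ from congrFun htv 0, show t (v 1) = _ from congrFun htv 1]; rfl
      have ht : t ∈ Y := by
        by_contra hn
        have := hP t (by simpa [htj] using hs) hn
        rw [← Function.comp_assoc, htj, htw] at this
        exact this.1.elim (fun h => h rfl) fun h => h hv
      have ht' : t' ∈ Y := by
        by_contra hn
        have := hP t' (by simpa [htj'] using hs) hn
        rw [← Function.comp_assoc (g := j), htj', htw', ← Function.comp_assoc, htj'] at this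
        exact this.2 rfl
      obtain ⟨t₀, ht₀, -, h₁, h₂⟩ := hi t ht t' ht' (Subsingleton.elim _ _)
      refine ⟨t₀ ∘ j, hYX ht₀, ?_⟩
      rw [← htw, ← h₁]
      refine ((hgY t₀ ht₀).resolve_left fun h => hab ?_).symm
      have e0 : t₀ (v 0) = a := by
        rw [show t₀ (v 0) = _ from congrFun (h₂.trans htv') 0]; rfl
      have e1 : t₀ (v 1) = b := by
        rw [show t₀ (v 1) = _ from congrFun (h₂.trans htv') 1]; rfl
      rw [← e0, ← e1, h]
    · rw [not_nontrivial_iff_subsingleton] at hM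
      exact ⟨s, hs, Subsingleton.elim _ _⟩
  · intro h
    -- By the inclusion, each value of `w` in this team is a value of `z` in `X`, so it can be
    -- paired with any `v` through the first alternative.
    refine ⟨{t | t ∘ j ∈ X ∧ (t ∘ w = t ∘ j ∘ z ∨ t (v 0) = t (v 1) ∧ t ∘ w = t ∘ j ∘ x)},
      fun t ht => ht.1, ⟨(hg M _).2 fun t ht => ht.2.elim Or.inr fun h => Or.inl h.1, ?_⟩, ?_⟩
    · intro t ht t' ht' _
      have : ∃ s ∈ X, s ∘ z = t ∘ w := by
        rcases ht.2 with h' | ⟨-, h'⟩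
        · exact ⟨_, ht.1, h'.symm⟩
        · rw [h']; exact h _ ht.1
      obtain ⟨s, hs, hsz⟩ := this
      obtain ⟨t₀, h₁, h₂, h₃⟩ := hex M s (t ∘ w) (t' ∘ v)
      refine ⟨t₀, ⟨by simpa [h₁] using hs, Or.inl ?_⟩, Subsingleton.elim _ _, h₂, h₃⟩
      rw [← Function.comp_assoc, h₁, h₂, hsz]
    · intro t ht hn
      by_cases h1 : t ∘ w = t ∘ j ∘ z
      · exact absurd ⟨ht, Or.inl h1⟩ hn
      · refine ⟨?_, h1⟩
        by_contra! hc
        exact hn ⟨ht, Or.inr ⟨hc.2, hc.1⟩⟩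

theorem exists_inclusion {Γ I : Type} [Finite I] (x z : I → Γ) :
    ∃ φ : IFormula L q Γ, ∀ (M : Type w) [L.Structure M] (X : Team Γ M),
      φ.Sat Q X ↔ ∀ s ∈ X, ∃ s' ∈ X, s' ∘ z = s ∘ x := by
  obtain ⟨n, ⟨e⟩⟩ := Finite.exists_equiv_fin I
  obtain ⟨φ, hφ⟩ := exists_inclusion_fin L Q (x ∘ e.symm) (z ∘ e.symm)
  refine ⟨φ, fun M _ X => ?_⟩
  simp only [hφ, ← Function.comp_assoc, e.symm.surjective.injective_comp_right.eq_iff]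

/-- Existential quantification of a function `g`, with a graph carried by new variables. -/
theorem exists_ex_fun (m r : ℕ) (Γ : Type) :
    ∃ (Γ' : Type) (j : Γ → Γ') (c : Fin m → Γ') (x : Fin r → Γ') (y : Γ'),
    (∀ (M : Type w) (s : Γ → M) (a : Fin m → M) (b : Fin r → M) (d : M),
      ∃ t : Γ' → M, t ∘ j = s ∧ t ∘ c = a ∧ t ∘ x = b ∧ t y = d) ∧
    ∀ φ' : IFormula L q Γ', ∃ φ : IFormula L q Γ,
      ∀ (M : Type w) [Nonempty M] [L.Structure M] (X : Team Γ M),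
        φ.Sat Q X ↔ ∃ g : (Fin m → M) → (Fin r → M) → M,
          φ'.Sat Q {t | t ∘ j ∈ X ∧ t y = g (t ∘ c) (t ∘ x)} := by
  obtain ⟨Γ₁, j, c, x, hex, hall⟩ := exists_all_tuple₂ L Q m r Γ
  refine ⟨Γ₁ ⊕ Fin 1, Sum.inl ∘ j, Sum.inl ∘ c, Sum.inl ∘ x, Sum.inr 0, fun M s a b d => ?_,
    fun φ' => ?_⟩
  · obtain ⟨t, rfl, rfl, rfl⟩ := hex M s a b
    exact ⟨extendOne t d, rfl, rfl, rfl, rfl⟩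
  · obtain ⟨φ, hφ⟩ := hall (.ex (.and (.indep (fun _ : Fin 1 => Sum.inr 0)
      (Sum.inl ∘ Fin.append c x) (fun _ : Fin 1 => Sum.inr 0)) φ'))
    refine ⟨φ, fun M _ _ X => ?_⟩
    rw [hφ, IFormula.sat_ex]
    have happ : ∀ t t' : Γ₁ ⊕ Fin 1 → M, t ∘ (Sum.inl ∘ Fin.append c x) =
        t' ∘ (Sum.inl ∘ Fin.append c x) ↔ t ∘ (Sum.inl ∘ c) = t' ∘ (Sum.inl ∘ c) ∧
          t ∘ (Sum.inl ∘ x) = t' ∘ (Sum.inl ∘ x) := by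
      intro t t'
      simp only [funext_iff, Fin.forall_fin_add, Function.comp_apply, Fin.append_left,
        Fin.append_right]
    constructor
    · rintro ⟨f, hdep, hsat⟩
      set X' := {t : Γ₁ ⊕ Fin 1 → M | t ∘ Sum.inl ∈ {t | t ∘ j ∈ X} ∧
        t (Sum.inr 0) = f (t ∘ Sum.inl)} with hX'
      classical
      -- By dependence the chosen row is immaterial. The default occurs only for empty `X`;
      -- otherwise all values of `c` and `x` are present.
      let g : (Fin m → M) → (Fin r → M) → M := fun a b =>
        if h : ∃ t ∈ X', t ∘ (Sum.inl ∘ c) = a ∧ t ∘ (Sum.inl ∘ x) = b then h.choose (Sum.inr 0)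
        else Classical.arbitrary M
      have hg : ∀ t ∈ X', t (Sum.inr 0) = g (t ∘ (Sum.inl ∘ c)) (t ∘ (Sum.inl ∘ x)) := by
        intro t ht
        have h : ∃ t' ∈ X', t' ∘ (Sum.inl ∘ c) = t ∘ (Sum.inl ∘ c) ∧
          t' ∘ (Sum.inl ∘ x) = t ∘ (Sum.inl ∘ x) := ⟨t, ht, rfl, rfl⟩
        have hd := hdep t ht h.choose h.choose_spec.1
          ((happ _ _).2 ⟨h.choose_spec.2.1.symm, h.choose_spec.2.2.symm⟩)
        obtain ⟨t₀, -, -, h₁, h₂⟩ := hd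
        simp only [g, dif_pos h]
        exact (congrFun h₁ 0).symm.trans (congrFun h₂ 0)
      refine ⟨g, ?_⟩
      convert hsat using 1
      ext t
      refine ⟨fun ht => ⟨ht.1, ?_⟩, fun ht => ⟨ht.1, hg t ht⟩⟩
      have hmem : extendOne (t ∘ Sum.inl) (f (t ∘ Sum.inl)) ∈ X' := ⟨ht.1, rfl⟩
      exact ht.2.trans (hg _ hmem).symm
    · rintro ⟨g, hg⟩
      refine ⟨fun s => g (s ∘ c) (s ∘ x), ?_, hg⟩
      rintro t ⟨ht, h1⟩ t' ⟨ht', h1'⟩ he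
      refine ⟨t, ⟨ht, h1⟩, rfl, rfl, ?_⟩
      funext i
      have := (happ _ _).1 he
      simp only [Function.comp_apply, h1, h1']
      exact congrArg₂ g this.1 this.2

end

/-! ### Interpreting function and relation symbols in a team

The variables of a team are `Γ`; an assignment of the first-order variables `α` of an `ESO(Q)`
formula is read off through a map `ι : α → Γ`. -/

/-- How an `n`-ary function that depends on an assignment of `α` is read off from a team: it is a
function of the base structure, or `a ↦ g (s ∘ o, a)` where the variables `c`, `x`, `y` run through
the graph of `g`. -/
inductive FunCode (L : FirstOrder.Language.{u, v}) (α Γ : Type) (n : ℕ) : Type (max u 1)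
  | base (f : L.Functions n) : FunCode L α Γ n
  | code {m : ℕ} (o : Fin m → α) (c : Fin m → Γ) (x : Fin n → Γ) (y : Γ) : FunCode L α Γ n

/-- How an `n`-ary relation is read off from a team: it is a relation of the base structure, empty,
or the set where two functions agree. -/
inductive RelCode (L : FirstOrder.Language.{u, v}) (α Γ : Type) (n : ℕ) : Type (max u v 1)
  | base (R : L.Relations n) : RelCode L α Γ n
  | empty : RelCode L α Γ n
  | agree (F₁ F₂ : FunCode L α Γ n) : RelCode L α Γ n

/-- Properties relating variables `c`, `x`, `y` to a function `g`. -/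
abbrev GraphProp (Γ : Type) (M : Type w) : Type w :=
  ∀ ⦃m n : ℕ⦄, (Fin m → Γ) → (Fin n → Γ) → Γ → ((Fin m → M) → (Fin n → M) → M) → Prop

section Codes

variable {L : FirstOrder.Language.{u, v}} {α α' Γ Γ' : Type} {M : Type w}

/-- All assignments of the team are in the graph of `g`. -/
def SoundGraph (X : Team Γ M) : GraphProp Γ M := fun _ _ c x y g =>
  ∀ s ∈ X, s y = g (s ∘ c) (s ∘ x)

/-- Each assignment of the team can be moved to each point of the graph of `g`. -/
def RichGraph (ι : α → Γ) (X : Team Γ M) : GraphProp Γ M := fun _ _ c x y g =>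
  ∀ s ∈ X, ∀ a b, ∃ s' ∈ X, s' ∘ ι = s ∘ ι ∧ s' ∘ c = a ∧ s' ∘ x = b ∧ s' y = g a b

theorem SoundGraph.map {X : Team Γ M} {X' : Team Γ' M} (j : Γ → Γ') (h : ∀ t ∈ X', t ∘ j ∈ X)
    {m n : ℕ} {c : Fin m → Γ} {x : Fin n → Γ} {y : Γ} {g : (Fin m → M) → (Fin n → M) → M}
    (hg : SoundGraph X c x y g) : SoundGraph X' (j ∘ c) (j ∘ x) (j y) g :=
  fun t ht => hg _ (h t ht)

/-- Moves in `X` that fix the assignment `ι` lift to moves in `X'` that fix `ι'`; this is the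
constraint on the choices made in the converse directions below. -/
theorem RichGraph.map {ι : α → Γ} {ι' : α' → Γ'} {X : Team Γ M} {X' : Team Γ' M} (j : Γ → Γ')
    (h : ∀ t ∈ X', t ∘ j ∈ X ∧
      ∀ s' ∈ X, s' ∘ ι = t ∘ j ∘ ι → ∃ t' ∈ X', t' ∘ j = s' ∧ t' ∘ ι' = t ∘ ι')
    {m n : ℕ} {c : Fin m → Γ} {x : Fin n → Γ} {y : Γ} {g : (Fin m → M) → (Fin n → M) → M}
    (hg : RichGraph ι X c x y g) : RichGraph ι' X' (j ∘ c) (j ∘ x) (j y) g := by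
  intro t ht a b
  obtain ⟨hX, hm⟩ := h t ht
  obtain ⟨s', hs', h₁, h₂, h₃, h₄⟩ := hg _ hX a b
  obtain ⟨t', ht', rfl, h⟩ := hm s' hs' h₁
  exact ⟨t', ht', h, h₂, h₃, h₄⟩

variable [L.Structure M]

/-- The function `h` is read off by the given code. -/
def FunCode.Interp (D : GraphProp Γ M) {n : ℕ} (h : (α → M) → (Fin n → M) → M) :
    FunCode L α Γ n → Prop
  | .base f => ∀ v x, h v x = Structure.funMap f x
  | .code o c x y => ∃ g, (∀ v, h v = g (v ∘ o)) ∧ D c x y g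

/-- The relation `h` is read off by the given code. -/
def RelCode.Interp (D : GraphProp Γ M) {n : ℕ} (h : (α → M) → (Fin n → M) → Prop) :
    RelCode L α Γ n → Prop
  | .base R => ∀ v x, h v x ↔ Structure.RelMap R x
  | .empty => ∀ v x, ¬ h v x
  | .agree F₁ F₂ => ∃ h₁ h₂, F₁.Interp D h₁ ∧ F₂.Interp D h₂ ∧ ∀ v x, h v x ↔ h₁ v x = h₂ v x

/-- Change of variables. -/
def FunCode.map (a : α → α') (j : Γ → Γ') {n : ℕ} : FunCode L α Γ n → FunCode L α' Γ' n
  | .base f => .base f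
  | .code o c x y => .code (a ∘ o) (j ∘ c) (j ∘ x) (j y)

/-- Change of variables. -/
def RelCode.map (a : α → α') (j : Γ → Γ') {n : ℕ} : RelCode L α Γ n → RelCode L α' Γ' n
  | .base R => .base R
  | .empty => .empty
  | .agree F₁ F₂ => .agree (F₁.map a j) (F₂.map a j)

theorem FunCode.Interp.map {D : GraphProp Γ M} {D' : GraphProp Γ' M} (a : α → α') (j : Γ → Γ')
    (hD : ∀ {m n : ℕ} {c : Fin m → Γ} {x : Fin n → Γ} {y : Γ} {g}, D c x y g →
      D' (j ∘ c) (j ∘ x) (j y) g) {n : ℕ} {F : FunCode L α Γ n} {h : (α → M) → (Fin n → M) → M}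
    (hF : F.Interp D h) : (F.map a j).Interp D' (fun v => h (v ∘ a)) := by
  cases F with
  | base f => exact fun v => hF _
  | code o c x y =>
    obtain ⟨g, hg, hd⟩ := hF
    exact ⟨g, fun v => hg _, hD hd⟩

theorem RelCode.Interp.map {D : GraphProp Γ M} {D' : GraphProp Γ' M} (a : α → α') (j : Γ → Γ')
    (hD : ∀ {m n : ℕ} {c : Fin m → Γ} {x : Fin n → Γ} {y : Γ} {g}, D c x y g →
      D' (j ∘ c) (j ∘ x) (j y) g) {n : ℕ} {R : RelCode L α Γ n} {h : (α → M) → (Fin n → M) → Prop}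
    (hR : R.Interp D h) : (R.map a j).Interp D' (fun v => h (v ∘ a)) := by
  cases R with
  | base R => exact fun v => hR _
  | empty => exact fun v => hR _
  | agree F₁ F₂ =>
    obtain ⟨h₁, h₂, i₁, i₂, h⟩ := hR
    exact ⟨_, _, i₁.map a j hD, i₂.map a j hD, fun v => h _⟩

theorem FunCode.map_id {n : ℕ} (F : FunCode L α Γ n) : F.map id id = F := by
  cases F <;> rfl

theorem RelCode.map_id {n : ℕ} (R : RelCode L α Γ n) : R.map id id = R := by
  cases R <;> simp [RelCode.map, FunCode.map_id]

end Codes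

/-- Codes for all symbols of `L'`. -/
structure CodeEnv (L L' : FirstOrder.Language.{u, v}) (α Γ : Type) : Type (max u v 1) where
  /-- The codes of function symbols. -/
  fn : ∀ {n : ℕ}, L'.Functions n → FunCode L α Γ n
  /-- The codes of relation symbols. -/
  rl : ∀ {n : ℕ}, L'.Relations n → RelCode L α Γ n

namespace CodeEnv

variable {L L' : FirstOrder.Language.{u, v}} {α α' Γ Γ' : Type} {M : Type w}

/-- Change of variables. -/
def map (E : CodeEnv L L' α Γ) (a : α → α') (j : Γ → Γ') : CodeEnv L L' α' Γ' :=
  ⟨fun f => (E.fn f).map a j, fun R => (E.rl R).map a j⟩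

/-- Adding a code for a function symbol. -/
def addFun (E : CodeEnv L L' α Γ) {r : ℕ} (F : FunCode L α Γ r) : CodeEnv L (withFun L' r) α Γ where
  fn
    | .inl f => E.fn f
    | .inr OneSym.sym => F
  rl
    | .inl R => E.rl R
    | .inr e => nomatch e

/-- Adding a code for a relation symbol. -/
def addRel (E : CodeEnv L L' α Γ) {r : ℕ} (R : RelCode L α Γ r) : CodeEnv L (withRel L' r) α Γ where
  fn
    | .inl f => E.fn f
    | .inr e => nomatch e
  rl
    | .inl R => E.rl R
    | .inr OneSym.sym => R

/-- Forgetting the code of a function symbol. -/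
def dropFun {r : ℕ} (E : CodeEnv L (withFun L' r) α Γ) : CodeEnv L L' α Γ :=
  ⟨fun f => E.fn (.inl f), fun R => E.rl (.inl R)⟩

variable [L.Structure M]

/-- The structures `S v`, for assignments `v` of `α`, are read off by the given codes. -/
structure Interp (E : CodeEnv L L' α Γ) (D : GraphProp Γ M) (S : (α → M) → L'.Structure M) :
    Prop where
  fn : ∀ {n : ℕ} (f : L'.Functions n), (E.fn f).Interp D fun v => (S v).funMap f
  rl : ∀ {n : ℕ} (R : L'.Relations n), (E.rl R).Interp D fun v => (S v).RelMap R

theorem Interp.map {E : CodeEnv L L' α Γ} {D : GraphProp Γ M} {D' : GraphProp Γ' M}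
    {S : (α → M) → L'.Structure M} (a : α → α') (j : Γ → Γ')
    (hD : ∀ {m n : ℕ} {c : Fin m → Γ} {x : Fin n → Γ} {y : Γ} {g}, D c x y g →
      D' (j ∘ c) (j ∘ x) (j y) g) (h : E.Interp D S) :
    (E.map a j).Interp D' fun v => S (v ∘ a) :=
  ⟨fun f => (h.fn f).map a j hD, fun R => (h.rl R).map a j hD⟩

theorem Interp.mono {E : CodeEnv L L' α Γ} {D : GraphProp Γ M} {D' : GraphProp Γ M}
    {S : (α → M) → L'.Structure M}
    (hD : ∀ {m n : ℕ} {c : Fin m → Γ} {x : Fin n → Γ} {y : Γ} {g}, D c x y g → D' c x y g)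
    (h : E.Interp D S) : E.Interp D' S := by
  have := h.map (D' := D') id id hD
  simpa [CodeEnv.map, FunCode.map_id, RelCode.map_id] using this

theorem Interp.addFun {E : CodeEnv L L' α Γ} {D : GraphProp Γ M} {S : (α → M) → L'.Structure M}
    {r : ℕ} {F : FunCode L α Γ r} {g : (α → M) → (Fin r → M) → M} (h : E.Interp D S)
    (hF : F.Interp D g) : (E.addFun F).Interp D fun v => expandFun (S v) (g v) where
  fn
    | .inl f => h.fn f
    | .inr OneSym.sym => hF
  rl
    | .inl R => h.rl R
    | .inr e => nomatch e

theorem Interp.addRel {E : CodeEnv L L' α Γ} {D : GraphProp Γ M} {S : (α → M) → L'.Structure M}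
    {r : ℕ} {R : RelCode L α Γ r} {A : (α → M) → Set (Fin r → M)} (h : E.Interp D S)
    (hR : R.Interp D fun v x => x ∈ A v) : (E.addRel R).Interp D fun v => expandRel (S v) (A v) where
  fn
    | .inl f => h.fn f
    | .inr e => nomatch e
  rl
    | .inl R => h.rl R
    | .inr OneSym.sym => hR

/-- The reduct of an expansion by a function. -/
abbrev reduct {r : ℕ} (S : (withFun L' r).Structure M) : L'.Structure M :=
  ⟨fun f => S.funMap (.inl f), fun R => S.RelMap (.inl R)⟩

theorem Interp.dropFun {r : ℕ} {E : CodeEnv L (withFun L' r) α Γ} {D : GraphProp Γ M}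
    {S : (α → M) → (withFun L' r).Structure M} (h : E.Interp D S) :
    E.dropFun.Interp D fun v => reduct (S v) :=
  ⟨fun f => h.fn (.inl f), fun R => h.rl (.inl R)⟩

end CodeEnv

/-! ### Properties definable relative to codes -/

/-- The property `P` is defined by a formula of `I(Q)` in teams in which the symbols of `L'` are
read off by the codes `E`: the formula implies `P` for each assignment as soon as the team is in
the graphs of the coded functions, and follows from it if the graphs are completely represented. -/
def Definable {L L' : FirstOrder.Language.{u, v}} {q : ℕ} (Q : GenQuantifier.{w} q) {α Γ : Type}
    (E : CodeEnv L L' α Γ) (ι : α → Γ)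
    (P : ∀ M : Type w, L'.Structure M → (α → M) → Prop) : Prop :=
  ∃ φ : IFormula L q Γ, ∀ (M : Type w) [Nonempty M] [L.Structure M] (X : Team Γ M)
    (S : (α → M) → L'.Structure M),
    (E.Interp (SoundGraph X) S → φ.Sat Q X → ∀ s ∈ X, P M (S (s ∘ ι)) (s ∘ ι)) ∧
    (E.Interp (RichGraph ι X) S → (∀ s ∈ X, P M (S (s ∘ ι)) (s ∘ ι)) → φ.Sat Q X)

namespace Definable

variable {L L' L₂ : FirstOrder.Language.{u, v}} {q : ℕ} {Q : GenQuantifier.{w} q} {α Γ : Type}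
  {E : CodeEnv L L' α Γ} {ι : α → Γ} {P P' : ∀ M : Type w, L'.Structure M → (α → M) → Prop}

/-- The same formula serves for another signature and other codes. Uniformity in `D` covers the
sound and the rich case at once. -/
theorem transfer {E₂ : CodeEnv L L₂ α Γ} {P₂ : ∀ M : Type w, L₂.Structure M → (α → M) → Prop}
    (h : Definable Q E₂ ι P₂)
    (hP : ∀ (M : Type w) [Nonempty M] [L.Structure M] (D : GraphProp Γ M)
      (S : (α → M) → L'.Structure M), E.Interp D S →
      ∃ S₂, E₂.Interp D S₂ ∧ ∀ v, P₂ M (S₂ v) v ↔ P M (S v) v) : Definable Q E ι P := by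
  obtain ⟨φ, hφ⟩ := h
  refine ⟨φ, fun M _ _ X S => ⟨fun hE hs s hsX => ?_, fun hE hs => ?_⟩⟩
  · obtain ⟨S₂, h₂, he⟩ := hP M _ S hE
    exact (he _).1 ((hφ M X S₂).1 h₂ hs s hsX)
  · obtain ⟨S₂, h₂, he⟩ := hP M _ S hE
    exact (hφ M X S₂).2 h₂ fun s hsX => (he _).2 (hs s hsX)

theorem congr (h : Definable Q E ι P')
    (hP : ∀ (M : Type w) [Nonempty M] S v, P' M S v ↔ P M S v) : Definable Q E ι P :=
  h.transfer fun M _ _ _ S hS => ⟨S, hS, fun _ => hP M _ _⟩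

theorem of_flat {P : ∀ M : Type w, (α → M) → Prop}
    (h : FlatDefinable L Q fun M (s : Γ → M) => P M (s ∘ ι)) :
    Definable Q E ι fun M _ s => P M s := by
  obtain ⟨φ, hφ⟩ := h
  exact ⟨φ, fun M _ _ X S => ⟨fun _ => (hφ M X).1, fun _ => (hφ M X).2⟩⟩

theorem eq (x y : α) : Definable Q E ι fun _ _ s => s x = s y :=
  of_flat (FlatDefinable.eq (ι x) (ι y))

theorem ne (x y : α) : Definable Q E ι fun _ _ s => s x ≠ s y :=
  of_flat (FlatDefinable.ne (ι x) (ι y))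

theorem true : Definable Q E ι fun _ _ _ => True := of_flat FlatDefinable.true

theorem false : Definable Q E ι fun _ _ _ => False := of_flat FlatDefinable.false

theorem and (h : Definable Q E ι P) (h' : Definable Q E ι P') :
    Definable Q E ι fun M S s => P M S s ∧ P' M S s := by
  obtain ⟨φ, hφ⟩ := h
  obtain ⟨ψ, hψ⟩ := h'
  refine ⟨.and φ ψ, fun M _ _ X S => ⟨fun hE hs s hsX => ?_, fun hE hs => ?_⟩⟩
  · exact ⟨(hφ M X S).1 hE hs.1 s hsX, (hψ M X S).1 hE hs.2 s hsX⟩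
  · exact ⟨(hφ M X S).2 hE fun s h => (hs s h).1, (hψ M X S).2 hE fun s h => (hs s h).2⟩

theorem forall_fin : ∀ {n : ℕ} {P : Fin n → ∀ M : Type w, L'.Structure M → (α → M) → Prop},
    (∀ i, Definable Q E ι (P i)) → Definable Q E ι fun M S s => ∀ i, P i M S s
  | 0, _, _ => by simpa using Definable.true
  | _ + 1, _, h => by
    simp only [Fin.forall_fin_succ]
    exact (h 0).and (forall_fin fun i => h i.succ)

/-- Soundness passes to any parts of a split. Conversely, splitting by truth at `s ∘ ι` keeps or
removes all rows with the same assignment together, so both parts stay rich. -/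
theorem or (h : Definable Q E ι P) (h' : Definable Q E ι P') :
    Definable Q E ι fun M S s => P M S s ∨ P' M S s := by
  obtain ⟨φ, hφ⟩ := h
  obtain ⟨ψ, hψ⟩ := h'
  refine ⟨.or φ ψ, fun M _ _ X S => ⟨?_, fun hE hs => ?_⟩⟩
  · rintro hE ⟨Y, Z, rfl, hY, hZ⟩ s (hsY | hsZ)
    · exact Or.inl ((hφ M Y S).1 (hE.mono fun h s hs => h s (Or.inl hs)) hY s hsY)
    · exact Or.inr ((hψ M Z S).1 (hE.mono fun h s hs => h s (Or.inr hs)) hZ s hsZ)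
  · have hrich : ∀ K : (α → M) → Prop, E.Interp (RichGraph ι {s ∈ X | K (s ∘ ι)}) S := by
      refine fun K => hE.mono fun h => RichGraph.map id (fun t ht => ⟨ht.1, fun s' hs' he => ?_⟩) h
      exact ⟨s', ⟨hs', by rw [he]; exact ht.2⟩, rfl, he⟩
    refine ⟨{s ∈ X | P M (S (s ∘ ι)) (s ∘ ι)}, {s ∈ X | P' M (S (s ∘ ι)) (s ∘ ι)}, ?_,
      (hφ M _ S).2 (hrich fun v => P M (S v) v) fun s hs => hs.2,
      (hψ M _ S).2 (hrich fun v => P' M (S v) v) fun s hs => hs.2⟩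
    ext s
    refine ⟨fun h => (hs s h).imp (⟨h, ·⟩) (⟨h, ·⟩), fun h => h.elim (·.1) (·.1)⟩

/-- Codes stay sound if the team is extended by new variables. -/
theorem sound_extend {M : Type w} [L.Structure M] {X : Team Γ M} {S : (α → M) → L'.Structure M}
    {n : ℕ} {X' : Team (Γ ⊕ Fin n) M} (hX : ∀ t ∈ X', t ∘ Sum.inl ∈ X)
    (hE : E.Interp (SoundGraph X) S) :
    (E.map (Sum.inl : α → α ⊕ Fin n) Sum.inl).Interp (SoundGraph X') fun v => S (v ∘ Sum.inl) :=
  hE.map _ _ fun h => SoundGraph.map Sum.inl hX h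

/-- Codes stay rich if the values of new variables depend only on the assignment of `α`. -/
theorem rich_extend {M : Type w} [L.Structure M] {X : Team Γ M} {S : (α → M) → L'.Structure M}
    {n : ℕ} (K : (α → M) → (Fin n → M) → Prop) (hE : E.Interp (RichGraph ι X) S) :
    (E.map (Sum.inl : α → α ⊕ Fin n) Sum.inl).Interp (RichGraph (Sum.map ι id)
      {t : Γ ⊕ Fin n → M | t ∘ Sum.inl ∈ X ∧ K (t ∘ Sum.inl ∘ ι) (t ∘ Sum.inr)})
      fun v => S (v ∘ Sum.inl) := by
  refine hE.map _ _ fun h => RichGraph.map Sum.inl (fun t ht => ⟨ht.1, fun s' hs' he => ?_⟩) h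
  refine ⟨extendBy s' (t ∘ Sum.inr), ⟨hs', ?_⟩, rfl, ?_⟩
  · rw [← Function.comp_assoc, Sum.elim_comp_inl, Sum.elim_comp_inr, he]
    exact ht.2
  · funext i
    rcases i with i | i
    · exact congrFun he i
    · rfl

/-! ### First-order and generalized quantifiers relative to codes -/

section Quantifiers

variable {n : ℕ} {P₁ : ∀ M : Type w, L'.Structure M → (α ⊕ Fin 1 → M) → Prop}
  {P₂ : ∀ M : Type w, L'.Structure M → (α ⊕ Fin q → M) → Prop}

theorem comp_map_eq {M : Type w} (t : Γ ⊕ Fin n → M) :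
    t ∘ Sum.map ι id = extendBy (t ∘ Sum.inl ∘ ι) (t ∘ Sum.inr) := by
  funext i
  rcases i with i | i <;> rfl

theorem extendOne_eq {M : Type w} (t : Γ ⊕ Fin 1 → M) :
    t ∘ Sum.map ι id = extendOne (t ∘ Sum.inl ∘ ι) (t (Sum.inr 0)) := by
  rw [comp_map_eq]
  congr 1
  funext i
  rw [Subsingleton.elim i 0]; rfl

/-- The witness is chosen as a function of `s ∘ ι`, not of the whole row `s`, so that richness
survives. -/
theorem ex (h : Definable Q (E.map Sum.inl Sum.inl) (Sum.map ι id) P₁) :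
    Definable Q E ι fun M S s => ∃ a : M, P₁ M S (extendOne s a) := by
  obtain ⟨φ, hφ⟩ := h
  refine ⟨.ex φ, fun M _ _ X S => ⟨fun hE hs s hsX => ?_, fun hE hs => ?_⟩⟩
  · obtain ⟨f, hf⟩ := (IFormula.sat_ex _ _).1 hs
    have h := (hφ M _ _).1 (sound_extend (fun t ht => ht.1) hE) hf (extendOne s (f s)) ⟨hsX, rfl⟩
    rw [extendOne_eq] at h
    exact ⟨f s, h⟩
  · have : ∃ f : (α → M) → M, ∀ s ∈ X, P₁ M (S (s ∘ ι)) (extendOne (s ∘ ι) (f (s ∘ ι))) := by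
      classical
      refine ⟨fun v => if h : ∃ a, P₁ M (S v) (extendOne v a) then h.choose else
        Classical.arbitrary M, fun s hsX => ?_⟩
      have h : ∃ a, P₁ M (S (s ∘ ι)) (extendOne (s ∘ ι) a) := hs s hsX
      simp only [dif_pos h]
      exact h.choose_spec
    obtain ⟨f, hf⟩ := this
    refine (IFormula.sat_ex _ _).2 ⟨fun s => f (s ∘ ι), (hφ M _ _).2
      (rich_extend (fun v b => b 0 = f v) hE) fun t ht => ?_⟩
    rw [extendOne_eq, ht.2]
    exact hf _ ht.1

theorem all (h : Definable Q (E.map Sum.inl Sum.inl) (Sum.map ι id) P₁) :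
    Definable Q E ι fun M S s => ∀ a : M, P₁ M S (extendOne s a) := by
  obtain ⟨φ, hφ⟩ := h
  refine ⟨.all φ, fun M _ _ X S => ⟨fun hE hs s hsX a => ?_, fun hE hs => ?_⟩⟩
  · have h := (hφ M _ _).1 (sound_extend (fun t ht => ht) hE) ((IFormula.sat_all _ _).1 hs)
      (extendOne s a) hsX
    rw [extendOne_eq] at h
    exact h
  · refine (IFormula.sat_all _ _).2 ((hφ M _ fun v => S (v ∘ Sum.inl)).2 ?_
      fun t ht => ?_)
    · simpa using rich_extend (fun _ _ => True) hE
    · rw [extendOne_eq]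
      exact hs _ ht _

/-- The chosen set `F s` is only a subset of the truth set, whence monotonicity; conversely the
truth set itself is chosen, and it depends only on `s ∘ ι`. -/
theorem gq (hmono : Q.IsMonotone)
    (h : Definable Q (E.map Sum.inl Sum.inl) (Sum.map ι id) P₂) :
    Definable Q E ι fun M S s => {a : Fin q → M | P₂ M S (extendBy s a)} ∈ Q M := by
  obtain ⟨φ, hφ⟩ := h
  refine ⟨.gq φ, fun M _ _ X S => ⟨fun hE hs s hsX => ?_, fun hE hs => ?_⟩⟩
  · obtain ⟨F, hF, hsat⟩ := (IFormula.sat_gq _ _).1 hs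
    refine hmono M _ _ (fun a ha => ?_) (hF s hsX)
    have h := (hφ M _ _).1 (sound_extend (fun t ht => ht.1) hE) hsat (extendBy s a) ⟨hsX, ha⟩
    rw [comp_map_eq] at h
    exact h
  · refine (IFormula.sat_gq _ _).2
      ⟨fun s => {a | P₂ M (S (s ∘ ι)) (extendBy (s ∘ ι) a)}, hs, (hφ M _ _).2
        (rich_extend (fun v b => P₂ M (S v) (extendBy v b)) hE) fun t ht => ?_⟩
    rw [comp_map_eq]
    exact ht.2

end Quantifiers

/-- The hypothesis ranges over all contexts because each step of the recursion adds a variable. -/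
theorem ex_tuple : ∀ {n : ℕ} {α Γ : Type} (E : CodeEnv L L' α Γ) (ι : α → Γ)
    {P : ∀ M : Type w, L'.Structure M → (α → M) → (Fin n → M) → Prop},
    (∀ {α' Γ' : Type} (E' : CodeEnv L L' α' Γ') (ι' : α' → Γ') (a : α → α') (x : Fin n → α'),
      Definable Q E' ι' fun M S s => P M S (s ∘ a) (s ∘ x)) →
    Definable Q E ι fun M S s => ∃ b, P M S s b
  | 0, _, _, E, ι, P, h => (h E ι id Fin.elim0).congr fun M _ S v => by
    refine ⟨fun h => ⟨_, h⟩, fun ⟨b, h⟩ => ?_⟩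
    rwa [Subsingleton.elim b (v ∘ Fin.elim0)] at h
  | n + 1, α, Γ, E, ι, P, h => by
    refine (ex (ex_tuple (n := n) _ _ (P := fun M S s b =>
      P M S (s ∘ Sum.inl) (Fin.cons (s (Sum.inr 0)) b)) fun E' ι' a x => ?_)).congr
      fun M _ S v => ?_
    · refine (h E' ι' (a ∘ Sum.inl) (Fin.cons (a (Sum.inr 0)) x)).congr fun M _ S v => ?_
      rw [show v ∘ (Fin.cons (a (Sum.inr 0)) x : Fin (n + 1) → _) =
        Fin.cons (v (a (Sum.inr 0))) (v ∘ x) from ?_]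
      · rfl
      · funext i
        refine Fin.cases rfl (fun i => rfl) i
    · refine ⟨fun ⟨a, b, h⟩ => ⟨_, h⟩, fun ⟨b, h⟩ => ⟨b 0, Fin.tail b, ?_⟩⟩
      have : (Fin.cons (b 0) (Fin.tail b) : Fin (n + 1) → M) = b := Fin.cons_self_tail b
      simpa [this] using h

/-! ### Atomic formulas: unnesting terms and reading symbols off the team -/

section Atoms

/-- For a coded function the formula is an inclusion atom into the graph columns: soundness puts the
matching row on the graph, and richness provides that row. -/
theorem funCode {n : ℕ} (F : FunCode L α Γ n) (ι : α → Γ) (x : Fin n → α) (y : α) :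
    ∃ φ : IFormula L q Γ, ∀ (M : Type w) [L.Structure M] (X : Team Γ M)
      (h : (α → M) → (Fin n → M) → M),
      (F.Interp (SoundGraph X) h → φ.Sat Q X → ∀ s ∈ X, h (s ∘ ι) (s ∘ ι ∘ x) = s (ι y)) ∧
      (F.Interp (RichGraph ι X) h → (∀ s ∈ X, h (s ∘ ι) (s ∘ ι ∘ x) = s (ι y)) → φ.Sat Q X) := by
  cases F with
  | base f =>
    refine ⟨.eq (.func f fun i => .var (ι (x i))) (.var (ι y)), fun M _ X h => ⟨?_, ?_⟩⟩
    · intro hF hs s hsX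
      rw [hF]
      exact hs s hsX
    · intro hF hs s hsX
      have := hs s hsX
      rw [hF] at this
      exact this
  | @code m o c x' y' =>
    obtain ⟨φ, hφ⟩ := exists_inclusion L Q (Sum.elim (Sum.elim (ι ∘ o) (ι ∘ x)) fun _ : Unit => ι y)
      (Sum.elim (Sum.elim c x') fun _ : Unit => y')
    have key : ∀ (M : Type w) (s s' : Γ → M),
        s' ∘ (Sum.elim (Sum.elim c x') fun _ : Unit => y') =
          s ∘ (Sum.elim (Sum.elim (ι ∘ o) (ι ∘ x)) fun _ : Unit => ι y) ↔
        s' ∘ c = (s ∘ ι) ∘ o ∧ s' ∘ x' = s ∘ ι ∘ x ∧ s' y' = s (ι y) := by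
      intro M s s'
      simp only [funext_iff, Sum.forall, Function.comp_apply, Sum.elim_inl, Sum.elim_inr,
        forall_const, and_assoc]
    refine ⟨φ, fun M _ X h => ⟨?_, ?_⟩⟩
    · rintro ⟨g, hg, hX⟩ hs s hsX
      obtain ⟨s', hs', he⟩ := (hφ M X).1 hs s hsX
      obtain ⟨h₁, h₂, h₃⟩ := (key M s s').1 he
      rw [hg, ← h₁, ← h₂, ← h₃, ← hX s' hs']
    · rintro ⟨g, hg, hX⟩ hs
      refine (hφ M X).2 fun s hsX => ?_
      obtain ⟨s', hs', -, h₁, h₂, h₃⟩ := hX s hsX ((s ∘ ι) ∘ o) (s ∘ ι ∘ x)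
      refine ⟨s', hs', (key M s s').2 ⟨h₁, h₂, ?_⟩⟩
      rw [h₃, ← hs s hsX, hg]

theorem funMap_eq {n : ℕ} (f : L'.Functions n) (x : Fin n → α) (y : α) :
    Definable Q E ι fun _ S s => S.funMap f (s ∘ x) = s y := by
  obtain ⟨φ, hφ⟩ := funCode (Q := Q) (E.fn f) ι x y
  exact ⟨φ, fun M _ _ X S => ⟨fun hE => (hφ M X _).1 (hE.fn f), fun hE => (hφ M X _).2 (hE.fn f)⟩⟩

theorem realize_eq {β : Type} (t : L'.Term β) : ∀ {α Γ : Type} (E : CodeEnv L L' α Γ) (ι : α → Γ)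
    (e : β → α) (y : α), Definable Q E ι fun _ _ s => t.realize (s ∘ e) = s y := by
  induction t with
  | var x => exact fun E ι e y => eq (e x) y
  | func f ts ih =>
    intro α Γ E ι e y
    refine (ex_tuple E ι (P := fun _ S s b => (∀ i, (ts i).realize (s ∘ e) = b i) ∧
      S.funMap f b = s y) fun E' ι' a x => ?_).congr fun M _ S v => ?_
    · exact (forall_fin fun i => ih i E' ι' (a ∘ e) (x i)).and (funMap_eq f x (a y))
    · constructor
      · rintro ⟨b, hb, h⟩
        rwa [Term.realize_func, funext hb]
      · exact fun h => ⟨_, fun i => rfl, h⟩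

/-- The two codes become function symbols of an enlarged signature, whose values are named by two
new variables and compared by `K`, used for `=` and `≠`. -/
theorem agreeCode {K : ∀ M : Type w, M → M → Prop} {n : ℕ} (F₁ F₂ : FunCode L α Γ n)
    (x : Fin n → α)
    (hK : ∀ {L' : FirstOrder.Language.{u, v}} {α Γ : Type} (E : CodeEnv L L' α Γ) (ι : α → Γ) y₁ y₂,
      Definable Q E ι fun M _ s => K M (s y₁) (s y₂))
    (hP : ∀ (M : Type w) [L.Structure M] (D : GraphProp Γ M) S, E.Interp D S →
      ∃ h₁ h₂, F₁.Interp D h₁ ∧ F₂.Interp D h₂ ∧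
        ∀ v, K M (h₁ v (v ∘ x)) (h₂ v (v ∘ x)) ↔ P M (S v) v) :
    Definable Q E ι P := by
  refine (ex_tuple (n := 2) ((E.addFun F₁).addFun F₂) ι (P := fun M S s b =>
    S.funMap (Sum.inl (Sum.inr OneSym.sym)) (s ∘ x) = b 0 ∧
      S.funMap (Sum.inr OneSym.sym) (s ∘ x) = b 1 ∧ K M (b 0) (b 1)) fun E' ι' a y => ?_).transfer
      fun M _ _ D S hS => ?_
  · exact (funMap_eq _ (a ∘ x) (y 0)).and ((funMap_eq _ (a ∘ x) (y 1)).and (hK _ _ _ _))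
  · obtain ⟨h₁, h₂, i₁, i₂, he⟩ := hP M D S hS
    refine ⟨_, (hS.addFun i₁).addFun i₂, fun v => ?_⟩
    rw [← he]
    constructor
    · rintro ⟨b, h₁, h₂, h⟩
      rw [← h₁, ← h₂] at h
      exact h
    · exact fun h => ⟨![_, _], rfl, rfl, h⟩

theorem relMap {n : ℕ} (R : L'.Relations n) (x : Fin n → α) :
    Definable Q E ι fun _ S s => S.RelMap R (s ∘ x) := by
  rcases hR : E.rl R with R₀ | _ | ⟨F₁, F₂⟩
  · refine ⟨.rel R₀ fun i => .var (ι (x i)), fun M _ _ X S => ⟨fun hE hs s hsX => ?_,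
      fun hE hs s hsX => ?_⟩⟩
    · have := hE.rl R
      rw [hR] at this
      exact (this _ _).2 (hs s hsX)
    · have := hE.rl R
      rw [hR] at this
      exact (this _ _).1 (hs s hsX)
  · refine Definable.false.transfer (E₂ := E) fun M _ _ D S hS => ⟨S, hS, fun v => ?_⟩
    have := hS.rl R
    rw [hR] at this
    exact iff_of_false id (this _ _)
  · refine agreeCode F₁ F₂ x (K := fun _ a b => a = b) (fun E ι => eq) fun M _ D S hS => ?_
    have := hS.rl R
    rw [hR] at this
    obtain ⟨h₁, h₂, i₁, i₂, he⟩ := this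
    exact ⟨h₁, h₂, i₁, i₂, fun v => (he _ _).symm⟩

theorem not_relMap {n : ℕ} (R : L'.Relations n) (x : Fin n → α) :
    Definable Q E ι fun _ S s => ¬ S.RelMap R (s ∘ x) := by
  rcases hR : E.rl R with R₀ | _ | ⟨F₁, F₂⟩
  · refine ⟨.nrel R₀ fun i => .var (ι (x i)), fun M _ _ X S => ⟨fun hE hs s hsX => ?_,
      fun hE hs s hsX => ?_⟩⟩
    · have := hE.rl R
      rw [hR] at this
      exact fun h => hs s hsX ((this _ _).1 h)
    · have := hE.rl R
      rw [hR] at this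
      exact fun h => hs s hsX ((this _ _).2 h)
  · refine Definable.true.transfer (E₂ := E) fun M _ _ D S hS => ⟨S, hS, fun v => ?_⟩
    have := hS.rl R
    rw [hR] at this
    exact iff_of_true trivial (this _ _)
  · refine agreeCode F₁ F₂ x (K := fun _ a b => a ≠ b) (fun E ι => ne) fun M _ D S hS => ?_
    have := hS.rl R
    rw [hR] at this
    obtain ⟨h₁, h₂, i₁, i₂, he⟩ := this
    exact ⟨h₁, h₂, i₁, i₂, fun v => not_congr (he _ _).symm⟩

end Atoms

/-! ### Second-order quantifiers -/

section SecondOrder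

/-- The witness depends on the assignment of `α`. As `α` is finite, the assignment is a tuple of
extra arguments, over which the fresh variables `c` range independently of `ι`. -/
theorem exFun [Finite α] {r : ℕ} {P : ∀ M : Type w, (withFun L' r).Structure M → (α → M) → Prop}
    (E : CodeEnv L L' α Γ) (ι : α → Γ)
    (h : ∀ {Γ' : Type} (E' : CodeEnv L (withFun L' r) α Γ') (ι' : α → Γ'), Definable Q E' ι' P) :
    Definable Q E ι fun M S s => ∃ g : (Fin r → M) → M, P M (expandFun S g) s := by
  obtain ⟨m, ⟨e⟩⟩ := Finite.exists_equiv_fin α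
  obtain ⟨Γ', j, c, x, y, hex, hφ⟩ := exists_ex_fun L Q m r Γ
  obtain ⟨φ', hφ'⟩ := h ((E.map id j).addFun (.code e.symm c x y)) (j ∘ ι)
  obtain ⟨φ, hφ⟩ := hφ φ'
  refine ⟨φ, fun M _ _ X S => ⟨fun hE hs s hsX => ?_, fun hE hs => ?_⟩⟩
  · obtain ⟨g, hg⟩ := (hφ M X).1 hs
    -- Any row over `s` will do, since the conclusion only concerns `t ∘ j ∘ ι`.
    obtain ⟨t, rfl, h₁, h₂, h₃⟩ := hex M s (Classical.arbitrary _) (Classical.arbitrary _)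
      (g (Classical.arbitrary _) (Classical.arbitrary _))
    refine ⟨g ((t ∘ j ∘ ι) ∘ e.symm), (hφ' M _ fun v => expandFun (S v) (g (v ∘ e.symm))).1
      (CodeEnv.Interp.addFun (hE.map id j fun h => SoundGraph.map j (fun t ht => ht.1) h)
        ⟨g, fun v => rfl, fun t ht => ht.2⟩) hg t ⟨hsX, ?_⟩⟩
    rw [h₁, h₂, h₃]
  · have : ∃ g : (α → M) → (Fin r → M) → M, ∀ s ∈ X,
        P M (expandFun (S (s ∘ ι)) (g (s ∘ ι))) (s ∘ ι) := by
      classical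
      refine ⟨fun v => if h : ∃ g, P M (expandFun (S v) g) v then h.choose else
        Classical.arbitrary _, fun s hsX => ?_⟩
      have h : ∃ g, P M (expandFun (S (s ∘ ι)) g) (s ∘ ι) := hs s hsX
      simp only [dif_pos h]
      exact h.choose_spec
    obtain ⟨g, hg⟩ := this
    refine (hφ M X).2 ⟨fun a => g (a ∘ e), (hφ' M _ fun v => expandFun (S v) (g v)).2
      (CodeEnv.Interp.addFun (hE.map id j fun h => RichGraph.map j (fun t ht => ⟨ht.1, ?_⟩) h)
        ⟨fun a => g (a ∘ e), fun v => ?_, ?_⟩) fun t ht => hg _ ht.1⟩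
    · intro s' hs' he
      obtain ⟨t', rfl, h₁, h₂, h₃⟩ := hex M s' (t ∘ c) (t ∘ x) (t y)
      refine ⟨t', ⟨hs', ?_⟩, rfl, he⟩
      rw [h₁, h₂, h₃, ht.2]
    · simp [Function.comp_assoc]
    · intro t ht a b
      obtain ⟨t', h, h₁, h₂, h₃⟩ := hex M (t ∘ j) a b (g (a ∘ e) b)
      refine ⟨t', ⟨?_, ?_⟩, ?_, h₁, h₂, h₃⟩
      · rw [h]; exact ht.1
      · rw [h₁, h₂, h₃]
      · rw [← Function.comp_assoc, h]; rfl

/-- A proper nonempty `A` provides two distinct elements of `M`: a coordinate at which a member and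
a nonmember differ. The empty set must be excluded, as over a one-element universe all functions
agree. -/
theorem exists_agree_eq {M : Type w} [Nonempty M] {r : ℕ} {A : Set (Fin r → M)} (hA : A.Nonempty) :
    ∃ g₁ g₂ : (Fin r → M) → M, {x | g₁ x = g₂ x} = A := by
  obtain ⟨a, ha⟩ := hA
  by_cases h : A = Set.univ
  · exact ⟨Classical.arbitrary _, Classical.arbitrary _, by simp [h]⟩
  · obtain ⟨b, hb⟩ := (Set.ne_univ_iff_exists_notMem A).1 h
    obtain ⟨i, hi⟩ := Function.ne_iff.1 (show a ≠ b from fun h => hb (h ▸ ha))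
    classical
    refine ⟨fun _ => a i, fun x => if x ∈ A then a i else b i, ?_⟩
    ext x
    by_cases hx : x ∈ A <;> simp [hx, hi]

theorem exRel [Finite α] {r : ℕ} {P : ∀ M : Type w, (withRel L' r).Structure M → (α → M) → Prop}
    (E : CodeEnv L L' α Γ) (ι : α → Γ)
    (h : ∀ {Γ' : Type} (E' : CodeEnv L (withRel L' r) α Γ') (ι' : α → Γ'), Definable Q E' ι' P) :
    Definable Q E ι fun M S s => ∃ A : Set (Fin r → M), P M (expandRel S A) s := by
  have h₁ : Definable Q E ι fun M S s => P M (expandRel S ∅) s :=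
    (h (E.addRel .empty) ι).transfer fun M _ _ D S hS =>
      ⟨fun v => expandRel (S v) ∅, hS.addRel (A := fun _ => ∅) fun _ _ => id, fun v => Iff.rfl⟩
  -- After two function quantifiers, the codes of both functions are forgotten and recombined into
  -- one relation code.
  have h₂ := exFun E ι fun E₁ ι₁ => exFun (r := r) (P := fun M S s =>
    P M (expandRel (CodeEnv.reduct (L' := L') (r := r) (CodeEnv.reduct S))
      {x | S.funMap (Sum.inl (Sum.inr OneSym.sym)) x = S.funMap (Sum.inr OneSym.sym) x}) s)
      E₁ ι₁ fun E₂ ι₂ =>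
    (h (E₂.dropFun.dropFun.addRel (.agree (E₂.fn (Sum.inl (Sum.inr OneSym.sym)))
      (E₂.fn (Sum.inr OneSym.sym)))) ι₂).transfer fun M _ _ D S hS =>
      ⟨_, hS.dropFun.dropFun.addRel (A := fun v => {x |
        (S v).funMap (Sum.inl (Sum.inr OneSym.sym)) x = (S v).funMap (Sum.inr OneSym.sym) x})
        ⟨_, _, hS.fn _, hS.fn _, fun v x => Iff.rfl⟩, fun v => Iff.rfl⟩
  refine (h₁.or h₂).congr fun M _ S v => ⟨?_, ?_⟩
  · rintro (h | ⟨g₁, g₂, h⟩)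
    · exact ⟨_, h⟩
    · exact ⟨_, h⟩
  · rintro ⟨A, h⟩
    obtain rfl | hA := A.eq_empty_or_nonempty
    · exact Or.inl h
    · obtain ⟨g₁, g₂, rfl⟩ := exists_agree_eq hA
      exact Or.inr ⟨g₁, g₂, h⟩

end SecondOrder

theorem realize (hmono : Q.IsMonotone) (ψ : ESOFormula q L' α) :
    ∀ [Finite α] {Γ : Type} (E : CodeEnv L L' α Γ) (ι : α → Γ),
      Definable Q E ι fun _ S s => ψ.Realize Q S s := by
  induction ψ with
  | eq t₁ t₂ =>
    intro _ Γ E ι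
    refine (ex_tuple (n := 2) E ι (P := fun _ S s b => t₁.realize s = b 0 ∧ t₂.realize s = b 1 ∧
      b 0 = b 1) fun E' ι' a y => (realize_eq t₁ _ _ a (y 0)).and
        ((realize_eq t₂ _ _ a (y 1)).and (eq _ _))).congr fun M _ S v => ⟨?_, ?_⟩
    · rintro ⟨b, h₁, h₂, h⟩
      exact h₁.trans (h.trans h₂.symm)
    · exact fun h => ⟨![_, _], rfl, rfl, h⟩
  | neq t₁ t₂ =>
    intro _ Γ E ι
    refine (ex_tuple (n := 2) E ι (P := fun _ S s b => t₁.realize s = b 0 ∧ t₂.realize s = b 1 ∧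
      b 0 ≠ b 1) fun E' ι' a y => (realize_eq t₁ _ _ a (y 0)).and
        ((realize_eq t₂ _ _ a (y 1)).and (ne _ _))).congr fun M _ S v => ⟨?_, ?_⟩
    · rintro ⟨b, h₁, h₂, h⟩
      exact fun h' => h (h₁.symm.trans (h'.trans h₂))
    · exact fun h => ⟨![_, _], rfl, rfl, h⟩
  | rel R ts =>
    intro _ Γ E ι
    refine (ex_tuple E ι (P := fun _ S s b => (∀ i, (ts i).realize s = b i) ∧ S.RelMap R b)
      fun E' ι' a y => (forall_fin fun i => realize_eq (ts i) _ _ a (y i)).and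
        (relMap R y)).congr fun M _ S v => ⟨?_, ?_⟩
    · rintro ⟨b, hb, h⟩
      obtain rfl := funext hb
      exact h
    · exact fun h => ⟨_, fun _ => rfl, h⟩
  | nrel R ts =>
    intro _ Γ E ι
    refine (ex_tuple E ι (P := fun _ S s b => (∀ i, (ts i).realize s = b i) ∧ ¬ S.RelMap R b)
      fun E' ι' a y => (forall_fin fun i => realize_eq (ts i) _ _ a (y i)).and
        (not_relMap R y)).congr fun M _ S v => ⟨?_, ?_⟩
    · rintro ⟨b, hb, h⟩
      obtain rfl := funext hb
      exact h
    · exact fun h => ⟨_, fun _ => rfl, h⟩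
  | and _ _ h₁ h₂ => exact fun E ι => (h₁ E ι).and (h₂ E ι)
  | or _ _ h₁ h₂ => exact fun E ι => (h₁ E ι).or (h₂ E ι)
  | ex _ h => exact fun E ι => ex (h _ _)
  | all _ h => exact fun E ι => all (h _ _)
  | gq _ h => exact fun E ι => gq hmono (h _ _)
  | exRel r _ h => exact fun E ι => exRel E ι fun E' ι' => h E' ι'
  | exFun r _ h => exact fun E ι => exFun E ι fun E' ι' => h E' ι'

end Definable

/-! ### Expressing sentences of `ESO(Q)` about the relation of a team -/

/-- The codes of the symbols of `L ∪ {R}`, where `R` has the code `C`. -/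
def relEnv (L : FirstOrder.Language.{u, v}) {Γ : Type} {k : ℕ} (C : RelCode L Empty Γ k) :
    CodeEnv L (withRel L k) Empty Γ :=
  CodeEnv.addRel ⟨.base, .base⟩ C

theorem relEnv_interp {L : FirstOrder.Language.{u, v}} {M : Type w} [str : L.Structure M] {Γ : Type}
    {k : ℕ} {C : RelCode L Empty Γ k} {D : GraphProp Γ M} {A : Set (Fin k → M)}
    (hC : C.Interp D fun _ x => x ∈ A) : (relEnv L C).Interp D fun _ => expandRel str A :=
  CodeEnv.Interp.addRel (A := fun _ => A) (S := fun _ => str)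
    ⟨fun _ _ _ => rfl, fun _ _ _ => Iff.rfl⟩ hC

theorem ESOSentence.models_iff {q : ℕ} (Q : GenQuantifier.{w} q) {M : Type w}
    {L : FirstOrder.Language.{u, v}} (str : L.Structure M) (ψ : ESOSentence q L) (s : Empty → M) :
    ESOSentence.Models Q str ψ ↔ ESOFormula.Realize Q ψ str s := by
  exact Iff.of_eq (congrArg (ESOFormula.Realize Q ψ str) (Subsingleton.elim _ _))

/-- A team with coded functions `g₁`, `g₂` expresses that these agree exactly on its relation. -/
theorem exists_agree_teamRel (L : FirstOrder.Language.{u, v}) {q : ℕ} (Q : GenQuantifier.{w} q)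
    {k : ℕ} {Γ : Type} (z x₁ x₂ : Fin k → Γ) (y₁ y₂ : Γ) :
    ∃ φ : IFormula L q Γ, ∀ (M : Type w) [L.Structure M] (X : Team Γ M),
      φ.Sat Q X ↔ (∀ t ∈ X, t ∘ x₁ = t ∘ z → t ∘ x₂ = t ∘ z → t y₁ = t y₂) ∧
        ∃ Y ⊆ X, (∀ t ∈ Y, ∃ t' ∈ Y, t' ∘ z = t ∘ x₁) ∧
          ∀ t ∈ X, t ∉ Y → t ∘ x₁ ≠ t ∘ x₂ ∨ t y₁ ≠ t y₂ := by
  obtain ⟨φ₁, h₁⟩ : FlatDefinable L Q fun _ t => t ∘ x₁ ≠ t ∘ z ∨ t ∘ x₂ ≠ t ∘ z ∨ t y₁ = t y₂ :=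
    (FlatDefinable.tuple_ne _ _).or ((FlatDefinable.tuple_ne _ _).or (FlatDefinable.eq _ _))
  obtain ⟨ψ, hψ⟩ := exists_inclusion L Q x₁ z
  obtain ⟨φ₂, h₂⟩ := ((FlatDefinable.tuple_ne x₁ x₂).or (FlatDefinable.ne y₁ y₂)).or_sat ψ
  refine ⟨.and φ₁ φ₂, fun M _ X => ?_⟩
  rw [IFormula.Sat, h₁, h₂]
  simp only [hψ, imp_iff_not_or, ne_eq]

/-- Two parameter-free functions are quantified; `ρ` forces their agreement set to be `rel(X)` and
`χ` translates `ψ` with `R` coded by them. Nonemptiness makes `rel(X)` an agreement set and puts all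
graph points into the team. -/
theorem exists_express {q : ℕ} (Q : GenQuantifier.{w} q) (hmono : Q.IsMonotone)
    (L : FirstOrder.Language.{u, v}) (k : ℕ) (ψ : ESOSentence q (withRel L k)) {α : Type}
    (z : Fin k ≃ α) :
    ∃ φ : IFormula L q α, ∀ (M : Type w) [Nonempty M] [str : L.Structure M] (X : Team α M),
      X.Nonempty → (φ.Sat Q X ↔ ESOSentence.Models Q (expandRel str (teamRel z X)) ψ) := by
  obtain ⟨Γ₁, j₁, c₁, x₁, y₁, hex₁, hφ₁⟩ := exists_ex_fun L Q 0 k α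
  obtain ⟨Γ₂, j₂, c₂, x₂, y₂, hex₂, hφ₂⟩ := exists_ex_fun L Q 0 k Γ₁
  obtain ⟨ρ, hρ⟩ := exists_agree_teamRel L Q (j₂ ∘ j₁ ∘ z) (j₂ ∘ x₁) x₂ (j₂ y₁) y₂
  let ι : Empty → Γ₂ := Empty.elim
  obtain ⟨χ, hχ⟩ := Definable.realize hmono ψ (relEnv L (.agree
    (.code Fin.elim0 (j₂ ∘ c₁) (j₂ ∘ x₁) (j₂ y₁)) (.code Fin.elim0 c₂ x₂ y₂))) ι
  obtain ⟨φ', hφ'⟩ := hφ₂ (.and ρ χ)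
  obtain ⟨φ, hφ⟩ := hφ₁ φ'
  refine ⟨φ, fun M _ str X hX => ?_⟩
  let T (g₁ g₂ : (Fin 0 → M) → (Fin k → M) → M) : Team Γ₂ M :=
    {t | t ∘ j₂ ∈ {t | t ∘ j₁ ∈ X ∧ t y₁ = g₁ (t ∘ c₁) (t ∘ x₁)} ∧ t y₂ = g₂ (t ∘ c₂) (t ∘ x₂)}
  have hT : ∀ g₁ g₂, ∀ s ∈ X, ∀ a₁ a₂ b₁ b₂, ∃ t ∈ T g₁ g₂, t ∘ j₂ ∘ j₁ = s ∧ t ∘ j₂ ∘ c₁ = a₁ ∧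
      t ∘ j₂ ∘ x₁ = b₁ ∧ t (j₂ y₁) = g₁ a₁ b₁ ∧ t ∘ c₂ = a₂ ∧ t ∘ x₂ = b₂ ∧ t y₂ = g₂ a₂ b₂ := by
    intro g₁ g₂ s hs a₁ a₂ b₁ b₂
    obtain ⟨t₁, rfl, rfl, rfl, h₁⟩ := hex₁ M s a₁ b₁ (g₁ a₁ b₁)
    obtain ⟨t₂, rfl, rfl, rfl, h₂⟩ := hex₂ M t₁ a₂ b₂ (g₂ a₂ b₂)
    exact ⟨t₂, ⟨⟨hs, h₁⟩, h₂⟩, rfl, rfl, rfl, h₁, rfl, rfl, h₂⟩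
  have hρT : ∀ g₁ g₂, ρ.Sat Q (T g₁ g₂) ↔
      {b | g₁ Fin.elim0 b = g₂ Fin.elim0 b} = teamRel z X := by
    intro g₁ g₂
    have hg₁ : ∀ t ∈ T g₁ g₂, t (j₂ y₁) = g₁ Fin.elim0 (t ∘ j₂ ∘ x₁) := fun t ht => by
      rw [← Subsingleton.elim ((t ∘ j₂) ∘ c₁) Fin.elim0]; exact ht.1.2
    have hg₂ : ∀ t ∈ T g₁ g₂, t y₂ = g₂ Fin.elim0 (t ∘ x₂) := fun t ht => by
      rw [← Subsingleton.elim (t ∘ c₂) Fin.elim0]; exact ht.2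
    rw [hρ]
    constructor
    · rintro ⟨hA, Y, hYT, hY, hB⟩
      ext b
      constructor
      · intro hb
        obtain ⟨s, hs⟩ := hX
        -- A row with `x₁ = x₂ = b` has equal function values, so it cannot leave `Y`; the inclusion
        -- atom then shows that `b` is a value of `z`.
        obtain ⟨t, ht, -, -, e₁, f₁, -, e₂, f₂⟩ := hT g₁ g₂ s hs Fin.elim0 Fin.elim0 b b
        have htY : t ∈ Y := by
          by_contra hn
          rcases hB t ht hn with h | h
          · exact h (e₁.trans e₂.symm)
          · exact h (f₁.trans (hb.trans f₂.symm))
        obtain ⟨t', ht', he⟩ := hY t htY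
        exact ⟨_, (hYT ht').1.1, (he.trans e₁).symm⟩
      · rintro ⟨s, hs, rfl⟩
        obtain ⟨t, ht, e, -, e₁, f₁, -, e₂, f₂⟩ :=
          hT g₁ g₂ s hs Fin.elim0 Fin.elim0 (s ∘ z) (s ∘ z)
        have hz : t ∘ j₂ ∘ j₁ ∘ z = s ∘ z := by rw [← e]; rfl
        exact f₁.symm.trans ((hA t ht (e₁.trans hz.symm) (e₂.trans hz.symm)).trans f₂)
    · intro h
      refine ⟨fun t ht e₁ e₂ => ?_, {t ∈ T g₁ g₂ | t ∘ j₂ ∘ x₁ ∈ teamRel z X},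
        Set.sep_subset _ _, ?_, ?_⟩
      · rw [hg₁ t ht, hg₂ t ht, e₁, e₂]
        exact h.symm.subset ⟨_, ht.1.1, rfl⟩
      · rintro t ⟨ht, s, hs, he⟩
        obtain ⟨t', ht', e, -, e₁, -⟩ := hT g₁ g₂ s hs Fin.elim0 Fin.elim0 (s ∘ z) (s ∘ z)
        refine ⟨t', ⟨ht', s, hs, e₁⟩, ?_⟩
        rw [he, ← e]; rfl
      · intro t ht hn
        by_contra! hc
        refine hn ⟨ht, h.subset ?_⟩
        have := hc.2
        rw [hg₁ t ht, hg₂ t ht, ← hc.1] at this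
        exact this
  have hφT : φ.Sat Q X ↔ ∃ g₁ g₂, ρ.Sat Q (T g₁ g₂) ∧ χ.Sat Q (T g₁ g₂) := by
    simp only [hφ, hφ', IFormula.Sat, T]
  rw [hφT]
  constructor
  · rintro ⟨g₁, g₂, h, hs⟩
    rw [hρT] at h
    obtain ⟨s, hsX⟩ := hX
    obtain ⟨t, ht, -⟩ := hT g₁ g₂ s hsX Fin.elim0 Fin.elim0 (s ∘ z) (s ∘ z)
    have := (hχ M (T g₁ g₂) fun _ => expandRel str (teamRel z X)).1 (relEnv_interp
      ⟨fun _ => g₁ Fin.elim0, fun _ => g₂ Fin.elim0, ⟨g₁, fun v => ?_, fun t ht => ht.1.2⟩,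
        ⟨g₂, fun v => ?_, fun t ht => ht.2⟩, fun _ x => by rw [← h]; rfl⟩) hs t ht
    · exact (ESOSentence.models_iff _ _ _ _).2 this
    · exact congrArg g₁ (Subsingleton.elim _ _)
    · exact congrArg g₂ (Subsingleton.elim _ _)
  · intro h
    have hne : (teamRel z X).Nonempty := by
      obtain ⟨s, hs⟩ := hX
      exact ⟨_, s, hs, rfl⟩
    obtain ⟨g₁, g₂, hg⟩ := Definable.exists_agree_eq hne
    refine ⟨fun _ => g₁, fun _ => g₂, (hρT (fun _ => g₁) fun _ => g₂).2 hg,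
      (hχ M _ fun _ => expandRel str (teamRel z X)).2 (relEnv_interp
        ⟨fun _ => g₁, fun _ => g₂, ⟨fun _ => g₁, fun v => rfl, ?_⟩, ⟨fun _ => g₂, fun v => rfl, ?_⟩,
          fun _ x => by rw [← hg]; rfl⟩) fun t ht => ?_⟩
    · intro t ht a b
      obtain ⟨t', ht', -, h₁, h₂, h₃, -⟩ := hT (fun _ => g₁) (fun _ => g₂) _ ht.1.1 a a b b
      exact ⟨t', ht', Subsingleton.elim _ _, h₁, h₂, h₃⟩
    · intro t ht a b
      obtain ⟨t', ht', -, -, -, -, h₁, h₂, h₃⟩ := hT (fun _ => g₁) (fun _ => g₂) _ ht.1.1 a a b b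
      exact ⟨t', ht', Subsingleton.elim _ _, h₁, h₂, h₃⟩
    · exact (ESOSentence.models_iff _ _ _ _).1 h

theorem mainTheorem3 {q : ℕ} (Q : GenQuantifier.{w} q) (hmono : Q.IsMonotone)
    (hnontriv : Q.IsNontrivial) (L : FirstOrder.Language.{u, v}) (k : ℕ)
    (ψ : ESOSentence q (withRel L k)) {α : Type} (z : Fin k ≃ α) :
    ∃ φ : IFormula L q α, φ.FV = Set.univ ∧
      ∀ (M : Type w) [Nonempty M] [str : L.Structure M] (X : Team α M),
        φ.Sat Q X ↔
          (ESOSentence.Models Q (expandRel str (teamRel z X)) ψ ∨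
            ∀ y : Fin k → M, y ∉ teamRel z X) := by
  obtain ⟨φ, hφ⟩ := exists_express Q hmono L k ψ z
  -- The added atom holds in every team and serves to make all the variables `z` free.
  refine ⟨.and φ (.indep z z z), ?_, fun M _ str X => ?_⟩
  · simp [IFormula.FV]
  · have hz : (IFormula.indep z z z : IFormula L q α).Sat Q X :=
      fun s hs s' _ h => ⟨s, hs, rfl, rfl, h⟩
    obtain rfl | hX := X.eq_empty_or_nonempty
    · exact iff_of_true ⟨φ.sat_empty, hz⟩ (Or.inr fun y ⟨s, hs, _⟩ => hs)
    · have hne : ¬ ∀ y : Fin k → M, y ∉ teamRel z X := by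
        obtain ⟨s, hs⟩ := hX
        exact fun h => h _ ⟨s, hs, rfl⟩
      rw [IFormula.Sat, hφ M X hX]
      simp [hz, hne]
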